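/- There is an absolute constant $K>0$ with the following property. Let $\theta\in(0,1)$, $\alpha\in(\theta,1)$, let $n,N,p_1,\dots,p_N$ be natural numbers and $p=\sum_{i=1}^N p_i$. Let $\bm{X}=[\bm{X}_1,\dots,\bm{X}_N]\in\mathbb{R}^{n\times p}$, $\bm{X}_i\in\mathbb{R}^{n\times p_i}$, be a random matrix with i.i.d. Bernoulli–Gaussian entries $\mathrm{BG}(\theta)$, i.e. entries of law $(1-\theta)\delta_0+\theta\,\mathcal{N}(0,1)$. Let $\bm{D}_o,\bm{A},\bm{A}_1,\dots,\bm{A}_N$ be fixed (deterministic) orthogonal $n\times n$ matrices ($\bm{D}_o$ is the true dictionary, $\bm{A}$ and $\bm{A}_i$ are the centralized and the local dictionaries of the $t$-th iteration), and put $\bm{U}=\bm{A}\bm{D}_o$, $\bm{U}_i=\bm{A}_i\bm{D}_o$, $\delta=\max_i\|\bm{A}-\bm{A}_i\|_F$, $$\bm{B}=(\bm{U}\bm{X})^{\circ 3}\bm{X}^{\mathsf T},\qquad \bm{B}_i=(\bm{U}_i\bm{X}_i)^{\circ 3}\bm{X}_i^{\mathsf T},$$ where $\circ 3$ is the entrywise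 cube, and let $\sigma_n$ denote the smallest singular value. Suppose that $\delta>0$ and that there are a signed permutation matrix $\bm{P}$ and a real number $$\epsilon\in\left[0,\ \frac{\alpha-\theta}{2\alpha n(1-\theta)+3\sqrt2(1+\alpha)(1-\theta)+\alpha\theta}\right)$$ with $\|\bm{U}-\bm{P}\|_F\le\epsilon$ and $\|\bm{U}_i-\bm{P}\|_F\le\epsilon$ for all $i$. Let $$C=6\alpha\theta(1-\theta)(1-2n\epsilon)-6(1-\alpha)\theta^2-6\alpha\theta^2\epsilon-18\sqrt2(\alpha+1)\theta(1-\theta)\epsilon .$$ (Then $C>0$.) If $p\geq 2$ and $$\frac{p}{(\ln p)^4}\ \ge\ K\,\frac{\delta+2}{\delta C}\,n ,$$ then for every constant $c_2>6.8\times10^4$, with probability at least $$1-8np\theta\exp\left(-\frac{(\ln p)^2}{2}\right)-8n^2\exp\left(\frac{-3p\,\delta^2C^2}{c_2(\delta+2)^2n^2\theta+16n^{5/2}(\ln p)^4\,\delta(\delta+2)C}\right)$$ the denominator below is positive and $$\frac{2\left\|\bm{B}-\sum_{i}\bm{B}_i\right\|_F}{\sigma_n(\bm{B})+\sigma_n\left(\sum_{i}\bm{B}_i\right)}<\alpha\,\delta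 .$$ -/

import Mathlib

open MeasureTheory ProbabilityTheory
open scoped Matrix Matrix.Norms.Frobenius

noncomputable section

/-- The Bernoulli-Gaussian law `BG(θ)` (for `0 ≤ θ ≤ 1`): the law of `b * g` with `b ~ Ber(θ)` and
`g ~ N(0, 1)` independent, that is, the mixture `(1 - θ) δ₀ + θ N(0, 1)`. -/
def bernoulliGaussian (θ : ℝ) : Measure ℝ :=
  ENNReal.ofReal (1 - θ) • Measure.dirac 0 + ENNReal.ofReal θ • gaussianReal 0 1

/-- A random matrix whose entries are i.i.d. with law `BG(θ)`. -/
structure IsBernoulliGaussianMatrix {Ω : Type*} [MeasurableSpace Ω] (μ : Measure Ω)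
    {m κ : Type*} (θ : ℝ) (X : Ω → Matrix m κ ℝ) : Prop where
  measurable_entry : ∀ j k, Measurable fun ω => X ω j k
  law_entry : ∀ j k, μ.map (fun ω => X ω j k) = bernoulliGaussian θ
  indep : iIndepFun (fun (e : m × κ) ω => X ω e.1 e.2) μ

/-- Signed permutation matrices: exactly one nonzero entry, equal to `1` or `-1`, in every row and
every column. -/
def IsSignedPermutation {n : ℕ} (P : Matrix (Fin n) (Fin n) ℝ) : Prop :=
  ∃ (π : Equiv.Perm (Fin n)) (s : Fin n → ℝ), (∀ i, s i = 1 ∨ s i = -1) ∧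
    P = Matrix.of fun i j => if π i = j then s i else 0

/-- The smallest (that is, the `n`-th largest) singular value `σ_n` of an `n × n` matrix. Mathlib
lists the singular values in decreasing order, starting with the index `0`. -/
def sigmaMin {n : ℕ} (M : Matrix (Fin n) (Fin n) ℝ) : ℝ :=
  (Matrix.toEuclideanLin M).singularValues (n - 1)

/-- The matrix `(U X)^{∘3} Xᵀ`, where `∘3` is the entrywise third power. -/
def cubicGrad {n : ℕ} {κ : Type*} [Fintype κ] (U : Matrix (Fin n) (Fin n) ℝ)
    (X : Matrix (Fin n) κ ℝ) : Matrix (Fin n) (Fin n) ℝ :=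
  (U * X).map (fun a => a ^ 3) * Xᵀ

/-- The `i`-th block `X_i` of a matrix `X = [X_1, …, X_N]` whose columns are distributed over `N`
nodes, `q i` of them at the node `i`. -/
def localBlock {n N : ℕ} {q : Fin N → ℕ} (X : Matrix (Fin n) (Σ i, Fin (q i)) ℝ) (i : Fin N) :
    Matrix (Fin n) (Fin (q i)) ℝ :=
  X.submatrix id (fun k => ⟨i, k⟩)

/-- `max_i ‖A - A_i‖_F`, in the Frobenius norm. -/
def deviation {n N : ℕ} (A : Matrix (Fin n) (Fin n) ℝ) (Aloc : Fin N → Matrix (Fin n) (Fin n) ℝ) :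
    ℝ :=
  ⨆ i, ‖A - Aloc i‖

/-- The constant `C`. -/
def gapConst (n : ℕ) (α θ ε : ℝ) : ℝ :=
  6 * α * θ * (1 - θ) * (1 - 2 * n * ε) - 6 * (1 - α) * θ ^ 2 - 6 * α * θ ^ 2 * ε
    - 18 * √2 * (α + 1) * θ * (1 - θ) * ε

end

/-! For a Bernoulli–Gaussian column `x` and an orthogonal `U`, the mean of `(U x)^{∘3} xᵀ` is
`meanGrad θ U = 3θ(1-θ) U^{∘3} + 3θ² U` (`integral_linear_cube_mul`). So `B` should be near `p •
meanGrad θ U`, and the sum of the local gradients near `∑ q i • meanGrad θ (V i)`, where `V i`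
stands for the local matrix `A_i D_o`.

Between the means the estimate is deterministic (`ratio_lt_of_near_mean`). Near a signed permutation
`P`, `meanGrad θ U` is close to `3θ P`, all of whose singular values are `3θ`; this bounds the
denominator below. The cube map is strongly contracting there (`norm_cube_sub_cube_le`: Lipschitz
constant `3√2 ε` on orthogonal matrices), so the means differ by little more than `3θ² δ`. The
constant `C` is a lower bound for the gap left between the two sides, and a Frobenius error below `p
δ C / (2(δ+2))` in each gradient does not close it.

Such errors are likely (`entry_tail`): each entry is a sum over independent columns. Columns with an
entry above `L = log p` are replaced by zero, which makes the summands bounded; their second moment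
is at most `528 θ`, and Bernstein's inequality applies. The truncation bias is negligible for the
required sample size (`bias_le`). A union bound over entries and over the two gradients finishes the
proof. -/

/-! ### Frobenius norm and smallest singular value. -/

theorem frobenius_norm_sq {m k : Type*} [Fintype m] [Fintype k] (A : Matrix m k ℝ) :
    ‖A‖ ^ 2 = ∑ i, ∑ j, A i j ^ 2 := by
  rw [Matrix.frobenius_norm_def, ← Real.sqrt_eq_rpow, Real.sq_sqrt (by positivity)]
  simp

theorem row_sq_le_frobenius_norm_sq {m k : Type*} [Fintype m] [Fintype k] (A : Matrix m k ℝ)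
    (i : m) : ∑ j, A i j ^ 2 ≤ ‖A‖ ^ 2 := by
  rw [frobenius_norm_sq]
  exact Finset.single_le_sum (f := fun i => ∑ j, A i j ^ 2) (fun _ _ => by positivity)
    (Finset.mem_univ i)

theorem norm_toEuclideanLin_le {n : ℕ} (M : Matrix (Fin n) (Fin n) ℝ)
    (x : EuclideanSpace ℝ (Fin n)) : ‖Matrix.toEuclideanLin M x‖ ≤ ‖M‖ * ‖x‖ := by
  refine le_of_sq_le_sq ?_ (by positivity)
  rw [mul_pow, frobenius_norm_sq, EuclideanSpace.norm_sq_eq, EuclideanSpace.norm_sq_eq,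
    Finset.sum_mul]
  refine Finset.sum_le_sum fun i _ => ?_
  have := Finset.sum_mul_sq_le_sq_mul_sq Finset.univ (M i) x
  simpa [Matrix.toLpLin_apply, Matrix.mulVec, dotProduct] using this

/-- The smallest singular value is attained: an eigenvector `x` of `T* T` for its square satisfies
`‖T x‖ = σ_n ‖x‖`. -/
theorem le_sigmaMin {n : ℕ} (hn : 0 < n) (M : Matrix (Fin n) (Fin n) ℝ) (c : ℝ)
    (h : ∀ x, c * ‖x‖ ≤ ‖Matrix.toEuclideanLin M x‖) : c ≤ sigmaMin M := by
  unfold sigmaMin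
  set T := Matrix.toEuclideanLin M
  have hlt : n - 1 < Module.finrank ℝ (EuclideanSpace ℝ (Fin n)) := by simp; omega
  obtain ⟨x, hx⟩ := (T.hasEigenvalue_adjoint_comp_self_sq_singularValues hlt).exists_hasEigenvector
  have h1 : ‖T x‖ ^ 2 = (T.singularValues (n - 1) * ‖x‖) ^ 2 := by
    rw [← real_inner_self_eq_norm_sq, ← LinearMap.adjoint_inner_left]
    have := hx.apply_eq_smul
    rw [LinearMap.comp_apply] at this
    rw [this, real_inner_smul_left, real_inner_self_eq_norm_sq, mul_pow]
    rfl
  have hx0 : 0 < ‖x‖ := norm_pos_iff.mpr hx.2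
  have h2 : ‖T x‖ = T.singularValues (n - 1) * ‖x‖ :=
    (sq_eq_sq₀ (norm_nonneg _) (mul_nonneg (T.singularValues_nonneg _) hx0.le)).mp h1
  have h3 := h x
  rw [h2] at h3
  exact le_of_mul_le_mul_right h3 hx0

theorem IsSignedPermutation.norm_toEuclideanLin {n : ℕ} {P : Matrix (Fin n) (Fin n) ℝ}
    (hP : IsSignedPermutation P) (x : EuclideanSpace ℝ (Fin n)) :
    ‖Matrix.toEuclideanLin P x‖ = ‖x‖ := by
  obtain ⟨π, s, hs, rfl⟩ := hP
  rw [← sq_eq_sq₀ (norm_nonneg _) (norm_nonneg _), EuclideanSpace.norm_sq_eq,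
    EuclideanSpace.norm_sq_eq, ← Equiv.sum_comp π fun i => ‖x i‖ ^ 2]
  refine Finset.sum_congr rfl fun i _ => ?_
  rcases hs i with h | h <;> simp [Matrix.toLpLin_apply, Matrix.mulVec, dotProduct, h]

/-- Weyl-type perturbation: `s • P` stretches every vector by exactly `s`, and the Frobenius norm
dominates the operator norm of the error. -/
theorem sub_norm_le_sigmaMin {n : ℕ} (hn : 0 < n) {P : Matrix (Fin n) (Fin n) ℝ}
    (hP : IsSignedPermutation P) (M : Matrix (Fin n) (Fin n) ℝ) {s : ℝ} (hs : 0 ≤ s) :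
    s - ‖M - s • P‖ ≤ sigmaMin M := by
  refine le_sigmaMin hn M _ fun x => ?_
  have h1 := norm_toEuclideanLin_le (M - s • P) x
  have h2 : Matrix.toEuclideanLin M x
      = s • Matrix.toEuclideanLin P x + Matrix.toEuclideanLin (M - s • P) x := by
    simp
  have h3 := norm_sub_le (Matrix.toEuclideanLin M x) (Matrix.toEuclideanLin (M - s • P) x)
  rw [h2, add_sub_cancel_right, ← h2, norm_smul, hP.norm_toEuclideanLin, Real.norm_of_nonneg hs]
    at h3
  linarith

/-! ### Entrywise cubes of orthogonal matrices near a signed permutation. -/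

theorem orthogonal_row_sq {n : ℕ} {U : Matrix (Fin n) (Fin n) ℝ}
    (hU : U ∈ Matrix.orthogonalGroup (Fin n) ℝ) (i : Fin n) : ∑ j, U i j ^ 2 = 1 := by
  have := congrFun (congrFun ((Matrix.mem_orthogonalGroup_iff _ _).mp hU) i) i
  simpa [Matrix.mul_apply, sq, Matrix.star_apply] using this

theorem orthogonal_entry_sq_le {n : ℕ} {U : Matrix (Fin n) (Fin n) ℝ}
    (hU : U ∈ Matrix.orthogonalGroup (Fin n) ℝ) (i j : Fin n) : U i j ^ 2 ≤ 1 := by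
  rw [← orthogonal_row_sq hU i]
  exact Finset.single_le_sum (f := fun j => U i j ^ 2) (fun _ _ => by positivity)
    (Finset.mem_univ j)

/-- Entrywise, since `P` is its own entrywise cube and `a ↦ a³` is 3-Lipschitz on `[-1, 1]`. -/
theorem norm_cube_sub_signedPermutation_le {n : ℕ} {U P : Matrix (Fin n) (Fin n) ℝ}
    (hU : U ∈ Matrix.orthogonalGroup (Fin n) ℝ) (hP : IsSignedPermutation P) :
    ‖U.map (fun a => a ^ 3) - P‖ ≤ 3 * ‖U - P‖ := by
  refine le_of_sq_le_sq ?_ (by positivity)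
  rw [mul_pow, frobenius_norm_sq, frobenius_norm_sq, Finset.mul_sum]
  refine Finset.sum_le_sum fun i _ => ?_
  rw [Finset.mul_sum]
  refine Finset.sum_le_sum fun j _ => ?_
  have hu := orthogonal_entry_sq_le hU i j
  obtain ⟨π, s, hs, rfl⟩ := hP
  simp only [Matrix.sub_apply, Matrix.map_apply, Matrix.of_apply]
  generalize U i j = u at *
  have hub := abs_le.mp ((sq_le_one_iff_abs_le_one u).mp hu)
  split_ifs
  · rcases hs i with h | h <;> rw [h]
    · have e : (u ^ 3 - 1) ^ 2 = (u ^ 2 + u + 1) ^ 2 * (u - 1) ^ 2 := by ring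
      rw [e]
      gcongr
      · nlinarith
      · linarith
    · have e : (u ^ 3 - -1) ^ 2 = (u ^ 2 - u + 1) ^ 2 * (u - -1) ^ 2 := by ring
      rw [e]
      gcongr
      · nlinarith
      · linarith
  · have e : (u ^ 3 - 0) ^ 2 = (u ^ 2) ^ 2 * (u - 0) ^ 2 := by ring
    rw [e]
    gcongr
    nlinarith

/-- Row by row, from `u³ - v³ = (u² + uv + v²)(u - v)`. Off the support of `P` the entries are at
most `ε` in size, so the factor is at most `3ε² ≤ 3ε`. On the support the factor is only at most
`3`, but there `u - v` is itself small because the rows are unit vectors. Each case contributes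
`9ε²` times the squared row distance, hence `18ε² = (3√2 ε)²`. -/
theorem norm_cube_sub_cube_le {n : ℕ} {U V P : Matrix (Fin n) (Fin n) ℝ} {ε : ℝ}
    (hU : U ∈ Matrix.orthogonalGroup (Fin n) ℝ) (hV : V ∈ Matrix.orthogonalGroup (Fin n) ℝ)
    (hP : IsSignedPermutation P) (hUP : ‖U - P‖ ≤ ε) (hVP : ‖V - P‖ ≤ ε) (hε : ε ≤ 1) :
    ‖U.map (fun a => a ^ 3) - V.map (fun a => a ^ 3)‖ ≤ 3 * √2 * ε * ‖U - V‖ := by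
  have hε0 : 0 ≤ ε := (norm_nonneg _).trans hUP
  refine le_of_sq_le_sq ?_ (by positivity)
  rw [mul_pow, mul_pow, mul_pow, Real.sq_sqrt (by norm_num), frobenius_norm_sq, frobenius_norm_sq,
    Finset.mul_sum]
  refine Finset.sum_le_sum fun i _ => ?_
  have hUr := (row_sq_le_frobenius_norm_sq (U - P) i).trans (pow_le_pow_left₀ (norm_nonneg _) hUP 2)
  have hVr := (row_sq_le_frobenius_norm_sq (V - P) i).trans (pow_le_pow_left₀ (norm_nonneg _) hVP 2)
  have hU1 := orthogonal_row_sq hU i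
  have hV1 := orthogonal_row_sq hV i
  have hUe := orthogonal_entry_sq_le hU i
  have hVe := orthogonal_entry_sq_le hV i
  obtain ⟨π, s, hs, rfl⟩ := hP
  simp only [Matrix.sub_apply, Matrix.map_apply, Matrix.of_apply] at *
  generalize U i = u at *
  generalize V i = v at *
  have hs1 : s i ^ 2 = 1 := by rcases hs i with h | h <;> simp [h]
  generalize s i = s at *
  generalize π i = k at *
  set d := ∑ j, (u j - v j) ^ 2 with hd

  -- As `‖u‖ = ‖v‖`, the vector `u - v` is orthogonal to `u + v`, so `2s(u_k - v_k) = ⟨2s e_k - u -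
  -- v, u - v⟩`. Cauchy–Schwarz applies, the first vector having norm at most `2ε`.
  have hk : (u k - v k) ^ 2 ≤ ε ^ 2 * d := by
    have cs := Finset.sum_mul_sq_le_sq_mul_sq Finset.univ
      (fun j => (if k = j then s else 0) * 2 - u j - v j) (fun j => u j - v j)
    have e1 : ∑ j, ((if k = j then s else 0) * 2 - u j - v j) * (u j - v j)
        = 2 * s * (u k - v k) := by
      have : ∀ j, ((if k = j then s else 0) * 2 - u j - v j) * (u j - v j)
          = (if k = j then 2 * s * (u j - v j) else 0) - u j ^ 2 + v j ^ 2 := by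
        intro j; split_ifs <;> ring
      simp only [this, Finset.sum_add_distrib, Finset.sum_sub_distrib, hU1, hV1]
      simp
    have e2 : ∑ j, ((if k = j then s else 0) * 2 - u j - v j) ^ 2 ≤ 4 * ε ^ 2 := by
      calc _ ≤ ∑ j, (2 * (u j - if k = j then s else 0) ^ 2
              + 2 * (v j - if k = j then s else 0) ^ 2) := by
            refine Finset.sum_le_sum fun j _ => ?_
            generalize (if k = j then s else 0) = w
            nlinarith [sq_nonneg (u j - v j)]
        _ ≤ _ := by
            rw [Finset.sum_add_distrib, ← Finset.mul_sum, ← Finset.mul_sum]; linarith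
    rw [e1] at cs
    have hd0 : 0 ≤ d := by positivity
    have := cs.trans (mul_le_mul_of_nonneg_right e2 hd0)
    have e3 : (2 * s * (u k - v k)) ^ 2 = 4 * (u k - v k) ^ 2 := by
      rw [mul_pow, mul_pow, hs1]; ring
    rw [e3] at this
    linarith
  have key : ∀ j, (u j ^ 3 - v j ^ 3) ^ 2
      ≤ (if k = j then 9 * (ε ^ 2 * d) else 0) + 9 * ε ^ 2 * (u j - v j) ^ 2 := by
    intro j
    have e : (u j ^ 3 - v j ^ 3) ^ 2 = (u j ^ 2 + u j * v j + v j ^ 2) ^ 2 * (u j - v j) ^ 2 := by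
      ring
    have q0 : 0 ≤ u j ^ 2 + u j * v j + v j ^ 2 := by nlinarith [sq_nonneg (u j + v j)]
    rw [e]
    split_ifs with hj
    · subst hj
      have q1 : u k ^ 2 + u k * v k + v k ^ 2 ≤ 3 := by
        nlinarith [hUe k, hVe k, sq_nonneg (u k - v k)]
      have : (u k ^ 2 + u k * v k + v k ^ 2) ^ 2 ≤ 9 := by nlinarith
      nlinarith [sq_nonneg (u k - v k), mul_nonneg (sq_nonneg ε) (sq_nonneg (u k - v k))]
    · have bu : u j ^ 2 ≤ ε ^ 2 := by
        refine le_trans ?_ hUr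
        have := Finset.single_le_sum (f := fun j => (u j - if k = j then s else 0) ^ 2)
          (fun _ _ => by positivity) (Finset.mem_univ j)
        simpa [hj] using this
      have bv : v j ^ 2 ≤ ε ^ 2 := by
        refine le_trans ?_ hVr
        have := Finset.single_le_sum (f := fun j => (v j - if k = j then s else 0) ^ 2)
          (fun _ _ => by positivity) (Finset.mem_univ j)
        simpa [hj] using this
      have q1 : u j ^ 2 + u j * v j + v j ^ 2 ≤ 3 * ε := by
        nlinarith [sq_nonneg (u j - v j)]
      have : (u j ^ 2 + u j * v j + v j ^ 2) ^ 2 ≤ 9 * ε ^ 2 := by nlinarith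
      rw [zero_add]
      gcongr
  refine (Finset.sum_le_sum fun j _ => key j).trans (le_of_eq ?_)
  rw [Finset.sum_add_distrib, ← Finset.mul_sum, ← hd]
  simp
  ring

/-- The expectation of `(U x)^{∘3} xᵀ` for a Bernoulli-Gaussian vector `x` and orthogonal `U`. -/
noncomputable def meanGrad {n : ℕ} (θ : ℝ) (U : Matrix (Fin n) (Fin n) ℝ) :
    Matrix (Fin n) (Fin n) ℝ :=
  (3 * θ * (1 - θ)) • U.map (fun a => a ^ 3) + (3 * θ ^ 2) • U

theorem norm_meanGrad_sub_signedPermutation_le {n : ℕ} {U P : Matrix (Fin n) (Fin n) ℝ} {θ ε : ℝ}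
    (hθ : 0 ≤ θ) (hθ1 : θ ≤ 1) (hU : U ∈ Matrix.orthogonalGroup (Fin n) ℝ)
    (hP : IsSignedPermutation P) (hUP : ‖U - P‖ ≤ ε) :
    ‖meanGrad θ U - (3 * θ * (1 - θ) + 3 * θ ^ 2) • P‖
      ≤ 3 * θ * (1 - θ) * (3 * ε) + 3 * θ ^ 2 * ε := by
  have e : meanGrad θ U - (3 * θ * (1 - θ) + 3 * θ ^ 2) • P
      = (3 * θ * (1 - θ)) • (U.map (fun a => a ^ 3) - P) + (3 * θ ^ 2) • (U - P) := by
    unfold meanGrad; module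
  have ha : 0 ≤ 3 * θ * (1 - θ) := mul_nonneg (by positivity) (by linarith)
  rw [e]
  refine (norm_add_le _ _).trans ?_
  rw [norm_smul, norm_smul, Real.norm_of_nonneg ha, Real.norm_of_nonneg (by positivity)]
  gcongr
  exact (norm_cube_sub_signedPermutation_le hU hP).trans (by gcongr)

theorem norm_meanGrad_sub_meanGrad_le {n : ℕ} {U V P : Matrix (Fin n) (Fin n) ℝ} {θ ε : ℝ}
    (hθ : 0 ≤ θ) (hθ1 : θ ≤ 1)
    (hU : U ∈ Matrix.orthogonalGroup (Fin n) ℝ) (hV : V ∈ Matrix.orthogonalGroup (Fin n) ℝ)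
    (hP : IsSignedPermutation P) (hUP : ‖U - P‖ ≤ ε) (hVP : ‖V - P‖ ≤ ε) (hε : ε ≤ 1) :
    ‖meanGrad θ U - meanGrad θ V‖
      ≤ (3 * θ * (1 - θ) * (3 * √2 * ε) + 3 * θ ^ 2) * ‖U - V‖ := by
  have e : meanGrad θ U - meanGrad θ V
      = (3 * θ * (1 - θ)) • (U.map (fun a => a ^ 3) - V.map (fun a => a ^ 3))
        + (3 * θ ^ 2) • (U - V) := by
    unfold meanGrad; module
  have ha : 0 ≤ 3 * θ * (1 - θ) := mul_nonneg (by positivity) (by linarith)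
  rw [e]
  refine (norm_add_le _ _).trans ?_
  rw [norm_smul, norm_smul, Real.norm_of_nonneg ha, Real.norm_of_nonneg (by positivity), add_mul,
    mul_assoc (3 * θ * (1 - θ)) (3 * √2 * ε)]
  gcongr
  exact norm_cube_sub_cube_le hU hV hP hUP hVP hε

theorem norm_mul_orthogonal_right {n : ℕ} (M : Matrix (Fin n) (Fin n) ℝ)
    {D : Matrix (Fin n) (Fin n) ℝ} (hD : D ∈ Matrix.orthogonalGroup (Fin n) ℝ) :
    ‖M * D‖ = ‖M‖ := by
  rw [← sq_eq_sq₀ (norm_nonneg _) (norm_nonneg _), frobenius_norm_sq, frobenius_norm_sq]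
  have h : ∀ A : Matrix (Fin n) (Fin n) ℝ, ∑ i, ∑ j, A i j ^ 2 = (A * Aᵀ).trace := fun A => by
    simp [Matrix.trace, Matrix.mul_apply, sq]
  have hD' : D * Dᵀ = 1 := (Matrix.mem_orthogonalGroup_iff _ _).mp hD
  rw [h, h, Matrix.transpose_mul, Matrix.mul_assoc, ← Matrix.mul_assoc D, hD', Matrix.one_mul]

theorem norm_lt_of_entries_lt {n : ℕ} (hn : 0 < n) (A : Matrix (Fin n) (Fin n) ℝ) {r : ℝ}
    (h : ∀ i j, |A i j| < r / n) : ‖A‖ < r := by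
  have hn' : (0 : ℝ) < n := by exact_mod_cast hn
  have : Nonempty (Fin n) := ⟨⟨0, hn⟩⟩
  have hr : 0 < r / n := (abs_nonneg _).trans_lt (h ⟨0, hn⟩ ⟨0, hn⟩)
  have hr' : 0 < r := by
    have := mul_pos hr hn'
    rwa [div_mul_cancel₀ _ hn'.ne'] at this
  refine lt_of_pow_lt_pow_left₀ 2 hr'.le ?_
  rw [frobenius_norm_sq]
  calc ∑ i, ∑ j, A i j ^ 2 < ∑ _i : Fin n, ∑ _j : Fin n, (r / n) ^ 2 :=
        Finset.sum_lt_sum_of_nonempty Finset.univ_nonempty fun i _ =>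
          Finset.sum_lt_sum_of_nonempty Finset.univ_nonempty fun j _ =>
            sq_lt_sq' (abs_lt.mp (h i j)).1 (abs_lt.mp (h i j)).2
    _ = r ^ 2 := by simp; field_simp

/-! ### Bernstein's inequality and independence of columns. -/

section Bernstein

variable {Ω : Type*} [MeasurableSpace Ω] {μ : Measure Ω} [IsProbabilityMeasure μ]

/-- From `exp y ≤ 1 + y + y²` for `|y| ≤ 1`. Here `v` bounds the raw second moment, so no centring
is needed. -/
theorem mgf_le_of_abs_le {Z : Ω → ℝ} {M v t : ℝ} (hZ : Measurable Z) (hM : ∀ ω, |Z ω| ≤ M)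
    (hv : ∫ ω, Z ω ^ 2 ∂μ ≤ v) (ht : 0 ≤ t) (htM : t * M ≤ 1) :
    Integrable (fun ω => Real.exp (t * Z ω)) μ ∧
      mgf Z μ t ≤ Real.exp (t * ∫ ω, Z ω ∂μ + t ^ 2 * v) := by
  have i1 : Integrable Z μ :=
    Integrable.of_bound hZ.aestronglyMeasurable M (Filter.Eventually.of_forall hM)
  have i2 : Integrable (fun ω => Z ω ^ 2) μ := by
    refine Integrable.of_bound (hZ.pow_const 2).aestronglyMeasurable (M ^ 2)
      (Filter.Eventually.of_forall fun ω => ?_)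
    rw [norm_pow]
    exact pow_le_pow_left₀ (norm_nonneg _) (hM ω) 2
  have hb : ∀ ω, |t * Z ω| ≤ 1 := fun ω => by
    rw [abs_mul, abs_of_nonneg ht]
    exact (mul_le_mul_of_nonneg_left (hM ω) ht).trans htM
  have i3 : Integrable (fun ω => Real.exp (t * Z ω)) μ := by
    refine Integrable.of_bound (by fun_prop) (Real.exp 1) (Filter.Eventually.of_forall fun ω => ?_)
    rw [Real.norm_of_nonneg (Real.exp_pos _).le]
    exact Real.exp_le_exp.mpr (abs_le.mp (hb ω)).2
  refine ⟨i3, ?_⟩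
  have i4 : Integrable (fun ω => 1 + t * Z ω) μ := (integrable_const 1).add (i1.const_mul t)
  calc mgf Z μ t ≤ ∫ ω, ((1 + t * Z ω) + t ^ 2 * Z ω ^ 2) ∂μ := by
        refine integral_mono i3 (i4.add (i2.const_mul _)) fun ω => ?_
        have := (abs_le.mp (Real.abs_exp_sub_one_sub_id_le (hb ω))).2
        dsimp only
        nlinarith
    _ = 1 + t * ∫ ω, Z ω ∂μ + t ^ 2 * ∫ ω, Z ω ^ 2 ∂μ := by
        rw [integral_add i4 (i2.const_mul _), integral_add (integrable_const 1) (i1.const_mul t),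
          integral_const_mul, integral_const_mul]
        simp
    _ ≤ t * ∫ ω, Z ω ∂μ + t ^ 2 * v + 1 := by nlinarith [sq_nonneg t]
    _ ≤ _ := Real.add_one_le_exp _

/-- A one-sided **Bernstein inequality**. -/
theorem bernstein_ge {κ : Type*} [Fintype κ] {Z : κ → Ω → ℝ} {M v t : ℝ}
    (hind : iIndepFun Z μ) (hZ : ∀ k, Measurable (Z k)) (hM : ∀ k ω, |Z k ω| ≤ M)
    (hv : ∀ k, ∫ ω, Z k ω ^ 2 ∂μ ≤ v) (hv0 : 0 ≤ v) (hM0 : 0 < M) (ht : 0 < t) :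
    μ.real {ω | ∑ k, ∫ ω, Z k ω ∂μ + t ≤ ∑ k, Z k ω}
      ≤ Real.exp (-(t ^ 2 / (4 * Fintype.card κ * v + 2 * M * t))) := by
  set p : ℝ := (Fintype.card κ : ℝ)
  have hp : 0 ≤ p := by positivity
  have hden : 0 < 2 * p * v + M * t := by positivity
  -- This Chernoff parameter keeps `s M ≤ 1` and gives `p s² v ≤ s t / 2`, so half of the exponent
  -- `-s t` survives.
  set s := t / (2 * p * v + M * t) with hs
  have hs0 : 0 ≤ s := by positivity
  have hsM : s * M ≤ 1 := by
    rw [hs, div_mul_eq_mul_div, div_le_one hden]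
    nlinarith [mul_nonneg hp hv0]
  have hk := fun k => mgf_le_of_abs_le (hZ k) (hM k) (hv k) hs0 hsM
  have hint : Integrable (fun ω => Real.exp (s * (∑ k, Z k) ω)) μ :=
    hind.integrable_exp_mul_sum hZ fun k _ => (hk k).1
  have h := measure_ge_le_exp_mul_mgf (μ := μ) (X := ∑ k, Z k) (∑ k, ∫ ω, Z k ω ∂μ + t) hs0 hint
  simp only [Finset.sum_apply] at h
  refine h.trans ?_
  rw [hind.mgf_sum hZ]
  calc Real.exp (-s * (∑ k, ∫ ω, Z k ω ∂μ + t)) * ∏ k, mgf (Z k) μ s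
      ≤ Real.exp (-s * (∑ k, ∫ ω, Z k ω ∂μ + t))
          * ∏ k, Real.exp (s * ∫ ω, Z k ω ∂μ + s ^ 2 * v) := by
        gcongr with k
        · intro k _; exact mgf_nonneg
        · exact (hk k).2
    _ = Real.exp (-s * t + p * (s ^ 2 * v)) := by
        rw [← Real.exp_sum, ← Real.exp_add, Finset.sum_add_distrib, ← Finset.mul_sum]
        congr 1
        simp only [Finset.sum_const, Finset.card_univ, nsmul_eq_mul]
        ring
    _ ≤ _ := by
        apply Real.exp_le_exp.mpr
        have e : 4 * p * v + 2 * M * t = 2 * (2 * p * v + M * t) := by ring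
        have e2 : t ^ 2 / (4 * p * v + 2 * M * t) = s * t / 2 := by
          rw [e, hs]; field_simp
        have h3 : s * (2 * p * v) ≤ t := by
          rw [hs, div_mul_eq_mul_div, div_le_iff₀ hden]
          nlinarith [mul_pos hM0 ht, mul_pos (mul_pos hM0 ht) ht]
        rw [e2]
        nlinarith

/-- A two-sided **Bernstein inequality**. -/
theorem bernstein_abs_ge {κ : Type*} [Fintype κ] {Z : κ → Ω → ℝ} {M v t : ℝ}
    (hind : iIndepFun Z μ) (hZ : ∀ k, Measurable (Z k)) (hM : ∀ k ω, |Z k ω| ≤ M)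
    (hv : ∀ k, ∫ ω, Z k ω ^ 2 ∂μ ≤ v) (hv0 : 0 ≤ v) (hM0 : 0 < M) (ht : 0 < t) :
    μ.real {ω | t ≤ |∑ k, Z k ω - ∑ k, ∫ ω, Z k ω ∂μ|}
      ≤ 2 * Real.exp (-(t ^ 2 / (4 * Fintype.card κ * v + 2 * M * t))) := by
  have h1 := bernstein_ge hind hZ hM hv hv0 hM0 ht
  have h2 := bernstein_ge (Z := fun k ω => -Z k ω) (hind.comp (fun _ x => -x) fun _ => measurable_neg)
    (fun k => (hZ k).neg) (by simpa using hM) (by simpa using hv) hv0 hM0 ht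
  have hsub : {ω | t ≤ |∑ k, Z k ω - ∑ k, ∫ ω, Z k ω ∂μ|}
      ⊆ {ω | ∑ k, ∫ ω, Z k ω ∂μ + t ≤ ∑ k, Z k ω}
        ∪ {ω | ∑ k, ∫ ω, -Z k ω ∂μ + t ≤ ∑ k, -Z k ω} := by
    intro ω hω
    simp only [Set.mem_union, Set.mem_ofPred_eq, integral_neg, Finset.sum_neg_distrib] at hω ⊢
    rcases le_abs.mp hω with h | h
    · left; linarith
    · right; linarith
  calc _ ≤ _ := measureReal_mono hsub
    _ ≤ _ := measureReal_union_le _ _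
    _ ≤ _ := by linarith

/-- The columns of a random matrix with independent entries are independent. -/
theorem iIndepFun_columns {m κ : Type*} [Finite m] [Finite κ] {X : m → κ → Ω → ℝ}
    (hX : ∀ j k, Measurable (X j k)) (hind : iIndepFun (fun e : m × κ => X e.1 e.2) μ) :
    iIndepFun (fun k ω j => X j k ω) μ := by
  have hpr : ∀ (i : κ) (j : m), IsProbabilityMeasure (μ.map (X j i)) := fun i j =>
    Measure.isProbabilityMeasure_map (hX j i).aemeasurable
  have hs : iIndepFun (fun (e : (_ : κ) × m) => X e.2 e.1) μ :=
    hind.precomp (g := fun e : (_ : κ) × m => (e.2, e.1)) (by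
      rintro ⟨a, b⟩ ⟨c, d⟩ h
      simp only [Prod.mk.injEq] at h
      obtain ⟨rfl, rfl⟩ := h
      rfl)
  have hcol : ∀ k, iIndepFun (fun j => X j k) μ := fun k =>
    hind.precomp (g := fun j : m => (j, k)) fun a b h => (Prod.mk.inj h).1
  rw [iIndepFun_iff_map_fun_eq_infinitePi_map (by fun_prop)]
  have h1 := (iIndepFun_iff_map_fun_eq_infinitePi_map (by fun_prop)).mp hs
  have h2 := fun k => (iIndepFun_iff_map_fun_eq_infinitePi_map (by fun_prop)).mp (hcol k)
  simp_rw [h2]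
  -- Independence says that the joint law is a product; currying a product over pairs yields a
  -- product over columns of product laws.
  have h3 := Measure.infinitePi_map_piCurry (X := fun (_ : κ) (_ : m) => ℝ)
    (fun i j => μ.map (X j i))
  rw [← h3, ← h1, Measure.map_map (by fun_prop) (by fun_prop)]
  rfl

end Bernstein

/-! ### Moments of linear forms in Bernoulli–Gaussian variables. -/

section Moments

/-- These are the third and fourth moments of the standard Gaussian, read off its moment generating
function. -/
theorem gaussian_mgf_iteratedDeriv :
    iteratedDeriv 3 (fun t : ℝ => Real.exp (t ^ 2 / 2)) 0 = 0 ∧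
      iteratedDeriv 4 (fun t : ℝ => Real.exp (t ^ 2 / 2)) 0 = 3 := by
  have key : ∀ (f f' : ℝ → ℝ), (∀ t, HasDerivAt f (f' t) t) →
      deriv (fun t => f t * Real.exp (t ^ 2 / 2))
        = fun t => (f' t + f t * t) * Real.exp (t ^ 2 / 2) := by
    intro f f' hf
    funext t
    have h1 : HasDerivAt (fun t : ℝ => t ^ 2 / 2) t t := by
      have := (hasDerivAt_pow 2 t).div_const 2
      simpa using this
    have h2 := (hf t).mul h1.exp
    have h3 : deriv (fun t => f t * Real.exp (t ^ 2 / 2)) t = _ := h2.deriv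
    rw [h3]
    ring
  have e1 : deriv (fun t : ℝ => Real.exp (t ^ 2 / 2)) = fun t => t * Real.exp (t ^ 2 / 2) := by
    have := key (fun _ => 1) (fun _ => 0) (fun t => hasDerivAt_const t 1)
    simpa using this
  have e2 : deriv (fun t : ℝ => t * Real.exp (t ^ 2 / 2))
      = fun t => (1 + t ^ 2) * Real.exp (t ^ 2 / 2) := by
    have := key (fun t => t) (fun _ => 1) (fun t => hasDerivAt_id t)
    simpa [sq] using this
  have e3 : deriv (fun t : ℝ => (1 + t ^ 2) * Real.exp (t ^ 2 / 2))
      = fun t => (3 * t + t ^ 3) * Real.exp (t ^ 2 / 2) := by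
    rw [key (fun t => 1 + t ^ 2) (fun t => 2 * t) fun t => by
      simpa using (hasDerivAt_pow 2 t).const_add 1]
    funext t; ring
  have e4 : deriv (fun t : ℝ => (3 * t + t ^ 3) * Real.exp (t ^ 2 / 2))
      = fun t => (3 + 6 * t ^ 2 + t ^ 4) * Real.exp (t ^ 2 / 2) := by
    rw [key (fun t => 3 * t + t ^ 3) (fun t => 3 + 3 * t ^ 2) fun t => by
      simpa using! ((hasDerivAt_id t).const_mul 3).add (hasDerivAt_pow 3 t)]
    funext t; ring
  constructor
  · simp [iteratedDeriv_succ, iteratedDeriv_zero, e1, e2, e3]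
  · simp [iteratedDeriv_succ, iteratedDeriv_zero, e1, e2, e3, e4]

theorem zero_mem_interior_integrableExpSet_gaussian :
    0 ∈ interior (integrableExpSet id (gaussianReal 0 1)) := by
  simp [integrableExpSet_id_gaussianReal]

theorem gaussian_integrable_pow (k : ℕ) : Integrable (fun x : ℝ => x ^ k) (gaussianReal 0 1) :=
  integrable_pow_of_mem_interior_integrableExpSet zero_mem_interior_integrableExpSet_gaussian k

theorem gaussian_integral_pow_three : ∫ x, x ^ 3 ∂(gaussianReal 0 1) = 0 := by
  have h := iteratedDeriv_mgf_zero zero_mem_interior_integrableExpSet_gaussian 3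
  rw [mgf_id_gaussianReal] at h
  simp only [NNReal.coe_one, zero_mul, zero_add, one_mul] at h
  rw [gaussian_mgf_iteratedDeriv.1] at h
  exact h.symm

theorem gaussian_integral_pow_four : ∫ x, x ^ 4 ∂(gaussianReal 0 1) = 3 := by
  have h := iteratedDeriv_mgf_zero zero_mem_interior_integrableExpSet_gaussian 4
  rw [mgf_id_gaussianReal] at h
  simp only [NNReal.coe_one, zero_mul, zero_add, one_mul] at h
  rw [gaussian_mgf_iteratedDeriv.2] at h
  exact h.symm

theorem gaussian_integral_sq : ∫ x, x ^ 2 ∂(gaussianReal 0 1) = 1 := by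
  have h := variance_fun_id_gaussianReal (μ := 0) (v := 1)
  rw [variance_of_integral_eq_zero (X := fun x : ℝ => x) measurable_id.aemeasurable (by simp)] at h
  simpa using h

variable {θ : ℝ}

theorem bernoulliGaussian_integrable {f : ℝ → ℝ} (hf : Integrable f (gaussianReal 0 1)) :
    Integrable f (bernoulliGaussian θ) := by
  unfold bernoulliGaussian
  exact ((integrable_dirac (by simp)).smul_measure ENNReal.ofReal_ne_top).add_measure
    (hf.smul_measure ENNReal.ofReal_ne_top)

theorem bernoulliGaussian_integral (hθ : 0 ≤ θ) (hθ1 : θ ≤ 1) {f : ℝ → ℝ}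
    (hf : Integrable f (gaussianReal 0 1)) :
    ∫ x, f x ∂(bernoulliGaussian θ) = (1 - θ) * f 0 + θ * ∫ x, f x ∂(gaussianReal 0 1) := by
  unfold bernoulliGaussian
  rw [integral_add_measure ((integrable_dirac (by simp)).smul_measure ENNReal.ofReal_ne_top)
    (hf.smul_measure ENNReal.ofReal_ne_top), integral_smul_measure, integral_smul_measure,
    integral_dirac, ENNReal.toReal_ofReal hθ, ENNReal.toReal_ofReal (by linarith)]
  rfl

variable {Ω : Type*} [MeasurableSpace Ω] {μ : Measure Ω}

theorem integrable_comp_of_law {x : Ω → ℝ} (hx : Measurable x)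
    (hlaw : μ.map x = bernoulliGaussian θ) {f : ℝ → ℝ} (hf : Integrable f (gaussianReal 0 1)) :
    Integrable (fun ω => f (x ω)) μ := by
  have h := bernoulliGaussian_integrable (θ := θ) hf
  rw [← hlaw] at h
  exact h.comp_measurable hx

theorem integral_comp_of_law (hθ : 0 ≤ θ) (hθ1 : θ ≤ 1) {x : Ω → ℝ} (hx : Measurable x)
    (hlaw : μ.map x = bernoulliGaussian θ) {f : ℝ → ℝ} (hf : Integrable f (gaussianReal 0 1)) :
    ∫ ω, f (x ω) ∂μ = (1 - θ) * f 0 + θ * ∫ x, f x ∂(gaussianReal 0 1) := by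
  rw [← bernoulliGaussian_integral hθ hθ1 hf, ← hlaw, integral_map hx.aemeasurable]
  rw [hlaw]
  exact (bernoulliGaussian_integrable hf).aestronglyMeasurable

theorem integrable_pow_of_law {x : Ω → ℝ} (hx : Measurable x)
    (hlaw : μ.map x = bernoulliGaussian θ) (k : ℕ) : Integrable (fun ω => x ω ^ k) μ :=
  integrable_comp_of_law hx hlaw (gaussian_integrable_pow k)

theorem integral_pow_of_law (hθ : 0 ≤ θ) (hθ1 : θ ≤ 1) {x : Ω → ℝ} (hx : Measurable x)
    (hlaw : μ.map x = bernoulliGaussian θ) :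
    ∫ ω, x ω ∂μ = 0 ∧ ∫ ω, x ω ^ 2 ∂μ = θ ∧ ∫ ω, x ω ^ 3 ∂μ = 0 ∧ ∫ ω, x ω ^ 4 ∂μ = 3 * θ := by
  have h := fun k => integral_comp_of_law hθ hθ1 hx hlaw (gaussian_integrable_pow k)
  refine ⟨?_, ?_, ?_, ?_⟩
  · simpa using h 1
  · simpa [gaussian_integral_sq] using h 2
  · simpa [gaussian_integral_pow_three] using h 3
  · simpa [gaussian_integral_pow_four, mul_comm] using h 4

theorem mgf_of_law (hθ : 0 ≤ θ) (hθ1 : θ ≤ 1) {x : Ω → ℝ} (hx : Measurable x)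
    (hlaw : μ.map x = bernoulliGaussian θ) (t : ℝ) :
    Integrable (fun ω => Real.exp (t * x ω)) μ ∧
      mgf x μ t = 1 - θ + θ * Real.exp (t ^ 2 / 2) := by
  have hi := integrable_exp_mul_gaussianReal (μ := 0) (v := 1) t
  refine ⟨integrable_comp_of_law hx hlaw hi, ?_⟩
  have h := integral_comp_of_law hθ hθ1 hx hlaw hi
  have h2 : ∫ x, Real.exp (t * x) ∂(gaussianReal 0 1) = Real.exp (t ^ 2 / 2) := by
    have := congrFun (mgf_id_gaussianReal (μ := 0) (v := 1)) t
    simpa [mgf] using this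
  rw [h2] at h
  simpa [mgf] using h

/-- For `a, b ≥ 1`, `(1-θ+θa)(1-θ+θb) = 1-θ+θab - θ(1-θ)(a-1)(b-1)`: sharing one Bernoulli switch
among all factors can only increase the product. This bounds the moment generating function of a
unit linear form by that of one `BG(θ)` variable, keeping the factor `θ` independently of the
dimension. -/
theorem prod_bernoulli_exp_le {m : Type*} (hθ : 0 ≤ θ) (hθ1 : θ ≤ 1) (s : Finset m) (c : m → ℝ)
    (hc : ∀ i, 0 ≤ c i) :
    ∏ i ∈ s, (1 - θ + θ * Real.exp (c i)) ≤ 1 - θ + θ * Real.exp (∑ i ∈ s, c i) := by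
  classical
  induction s using Finset.induction_on with
  | empty => simp
  | insert i s hi ih =>
    rw [Finset.prod_insert hi, Finset.sum_insert hi, Real.exp_add]
    have ha := Real.one_le_exp (hc i)
    have hb := Real.one_le_exp (Finset.sum_nonneg fun i (_ : i ∈ s) => hc i)
    generalize Real.exp (c i) = a at *
    generalize Real.exp (∑ i ∈ s, c i) = b at *
    have h0 : 0 ≤ 1 - θ + θ * a := by nlinarith
    refine (mul_le_mul_of_nonneg_left ih h0).trans ?_
    have : 0 ≤ θ * (1 - θ) * ((a - 1) * (b - 1)) :=
      mul_nonneg (mul_nonneg hθ (by linarith)) (mul_nonneg (by linarith) (by linarith))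
    nlinarith

/-- Two-sided tail bound for the Bernoulli-Gaussian law. -/
theorem measure_abs_gt_le (hθ : 0 ≤ θ) {x : Ω → ℝ} (hx : Measurable x)
    (hlaw : μ.map x = bernoulliGaussian θ) {L : ℝ} (hL : 0 ≤ L) :
    μ.real {ω | L < |x ω|} ≤ 2 * θ * Real.exp (-(L ^ 2 / 2)) := by
  have hms : MeasurableSet {y : ℝ | L < |y|} := measurableSet_lt measurable_const (by fun_prop)
  -- The atom at `0` lies outside the tail, whence the factor `θ`; the Gaussian tail is then a
  -- Chernoff bound with parameter `L`.
  have h1 : μ.real {ω | L < |x ω|} = θ * (gaussianReal 0 1).real {y | L < |y|} := by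
    have : μ.real {ω | L < |x ω|} = (bernoulliGaussian θ).real {y | L < |y|} := by
      rw [← hlaw, map_measureReal_apply hx hms]; rfl
    rw [this]
    have h0 : (Measure.dirac (0 : ℝ)) {y : ℝ | L < |y|} = 0 := by
      rw [Measure.dirac_apply' _ hms]; simp [hL]
    simp [bernoulliGaussian, measureReal_def, h0, ENNReal.toReal_ofReal hθ]
  have e2 : Real.exp (-L * L) * Real.exp (L ^ 2 / 2) = Real.exp (-(L ^ 2 / 2)) := by
    rw [← Real.exp_add]; congr 1; ring
  have h2 := measure_ge_le_exp_mul_mgf (μ := gaussianReal 0 1) (X := id) L hL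
    (integrable_exp_mul_gaussianReal L)
  have h3 := measure_le_le_exp_mul_mgf (μ := gaussianReal 0 1) (X := id) (-L)
    (neg_nonpos.mpr hL) (integrable_exp_mul_gaussianReal (-L))
  rw [mgf_id_gaussianReal] at h2 h3
  simp only [NNReal.coe_one, zero_mul, zero_add, one_mul, neg_sq, neg_neg, id_eq] at h2 h3
  have e3 : Real.exp (L * -L) * Real.exp (L ^ 2 / 2) = Real.exp (-(L ^ 2 / 2)) := by
    rw [← Real.exp_add]; congr 1; ring
  rw [e2] at h2
  rw [e3] at h3
  have hsub : {y : ℝ | L < |y|} ⊆ {y | L ≤ y} ∪ {y | y ≤ -L} := by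
    intro y hy
    rcases lt_abs.mp (show L < |y| from hy) with h | h
    · exact Or.inl h.le
    · exact Or.inr (show y ≤ -L by linarith)
  have h4 := (measureReal_mono (μ := gaussianReal 0 1) hsub).trans (measureReal_union_le _ _)
  rw [h1]
  have : θ * (gaussianReal 0 1).real {y | L < |y|} ≤ θ * (2 * Real.exp (-(L ^ 2 / 2))) :=
    mul_le_mul_of_nonneg_left (by linarith) hθ
  linarith

variable {m : Type*} [Fintype m] {x : m → Ω → ℝ}

theorem integral_linear (hθ : 0 ≤ θ) (hθ1 : θ ≤ 1) (hx : ∀ i, Measurable (x i))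
    (hlaw : ∀ i, μ.map (x i) = bernoulliGaussian θ) (u : m → ℝ) :
    ∫ ω, ∑ i, u i * x i ω ∂μ = 0 := by
  rw [integral_finsetSum _ fun i _ => by
    simpa using (integrable_pow_of_law (hx i) (hlaw i) 1).const_mul (u i)]
  simp [integral_const_mul, (integral_pow_of_law hθ hθ1 (hx _) (hlaw _)).1]

theorem integral_linear_sq (hθ : 0 ≤ θ) (hθ1 : θ ≤ 1) (hx : ∀ i, Measurable (x i))
    (hlaw : ∀ i, μ.map (x i) = bernoulliGaussian θ) (hind : iIndepFun x μ) (u : m → ℝ) :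
    ∫ ω, (∑ i, u i * x i ω) ^ 2 ∂μ = θ * ∑ i, u i ^ 2 := by
  have hind' : iIndepFun (fun i ω => u i * x i ω) μ :=
    hind.comp (fun i y => u i * y) fun i => measurable_const_mul _
  have hL : ∀ i, MemLp (fun ω => u i * x i ω) 2 μ := fun i =>
    ((memLp_two_iff_integrable_sq (hx i).aestronglyMeasurable).mpr
      (integrable_pow_of_law (hx i) (hlaw i) 2)).const_mul (u i)
  have h := IndepFun.variance_sum (s := Finset.univ) (fun i _ => hL i)
    fun i _ j _ hij => hind'.indepFun hij
  have e : (∑ i, fun ω => u i * x i ω) = fun ω => ∑ i, u i * x i ω := by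
    funext ω; simp
  have hv : ∀ i, Var[fun ω => u i * x i ω; μ] = θ * u i ^ 2 := fun i => by
    rw [variance_const_mul, variance_of_integral_eq_zero (hx i).aemeasurable
      (integral_pow_of_law hθ hθ1 (hx i) (hlaw i)).1,
      (integral_pow_of_law hθ hθ1 (hx i) (hlaw i)).2.1, mul_comm]
  rw [e, variance_of_integral_eq_zero (by fun_prop) (integral_linear hθ hθ1 hx hlaw u)] at h
  rw [h, Finset.mul_sum]
  exact Finset.sum_congr rfl fun i _ => hv i

variable [IsProbabilityMeasure μ]

theorem mgf_linear_le (hθ : 0 ≤ θ) (hθ1 : θ ≤ 1) (hx : ∀ i, Measurable (x i))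
    (hlaw : ∀ i, μ.map (x i) = bernoulliGaussian θ) (hind : iIndepFun x μ) (u : m → ℝ) (t : ℝ) :
    Integrable (fun ω => Real.exp (t * ∑ i, u i * x i ω)) μ ∧
      ∫ ω, Real.exp (t * ∑ i, u i * x i ω) ∂μ
        ≤ 1 - θ + θ * Real.exp (t ^ 2 * (∑ i, u i ^ 2) / 2) := by
  have hind' : iIndepFun (fun i ω => u i * x i ω) μ :=
    hind.comp (fun i y => u i * y) fun i => measurable_const_mul _
  have hm : ∀ i, Measurable (fun ω => u i * x i ω) := fun i => (hx i).const_mul _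
  have h1 := fun i => mgf_of_law hθ hθ1 (hx i) (hlaw i) (u i * t)
  constructor
  · have := hind'.integrable_exp_mul_sum (t := t) (s := Finset.univ) hm fun i _ => by
      refine (h1 i).1.congr (Filter.Eventually.of_forall fun ω => ?_)
      dsimp only
      congr 1; ring
    simpa using this
  · have h2 := hind'.mgf_sum (t := t) hm Finset.univ
    have h3 : mgf (∑ i, fun ω => u i * x i ω) μ t = ∫ ω, Real.exp (t * ∑ i, u i * x i ω) ∂μ := by
      simp [mgf]
    rw [← h3, h2]
    simp_rw [mgf_const_mul, (h1 _).2]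
    refine (prod_bernoulli_exp_le hθ hθ1 _ _ fun i => by positivity).trans (le_of_eq ?_)
    rw [Finset.mul_sum, Finset.sum_div]
    congr 3
    refine Finset.sum_congr rfl fun i _ => ?_
    ring

theorem pow_eight_le_cosh (y : ℝ) : y ^ 8 / 40320 ≤ Real.cosh y - 1 := by
  have h := sum_le_hasSum (Finset.range 5) (fun i _ => by
    rw [pow_mul]; positivity) (Real.hasSum_cosh y)
  simp only [Finset.sum_range_succ, Finset.sum_range_zero] at h
  norm_num [Nat.factorial] at h
  nlinarith [sq_nonneg y, sq_nonneg (y ^ 2), sq_nonneg (y ^ 3)]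

theorem integrable_linear_pow (hθ : 0 ≤ θ) (hθ1 : θ ≤ 1) (hx : ∀ i, Measurable (x i))
    (hlaw : ∀ i, μ.map (x i) = bernoulliGaussian θ) (hind : iIndepFun x μ) (u : m → ℝ) (k : ℕ) :
    Integrable (fun ω => (∑ i, u i * x i ω) ^ k) μ := by
  have huniv : integrableExpSet (fun ω => ∑ i, u i * x i ω) μ = Set.univ :=
    Set.eq_univ_of_forall fun t => (mgf_linear_le hθ hθ1 hx hlaw hind u t).1
  exact integrable_pow_of_mem_interior_integrableExpSet (by rw [huniv]; simp) k

theorem integral_linear_pow_eight_le (hθ : 0 ≤ θ) (hθ1 : θ ≤ 1) (hx : ∀ i, Measurable (x i))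
    (hlaw : ∀ i, μ.map (x i) = bernoulliGaussian θ) (hind : iIndepFun x μ) {u : m → ℝ}
    (hu : ∑ i, u i ^ 2 = 1) :
    ∫ ω, (∑ i, u i * x i ω) ^ 8 ∂μ ≤ 528 * θ := by
  -- `s² = 8` minimises `exp(s²/2) / s⁸`. The eighth-order term of `cosh` gives the bound `2θ(e⁴ -
  -- 1) · 20160 / 4096 ≤ 528 θ`, with `20160 = 8!/2` and `4096 = s⁸`.
  set s : ℝ := √8
  have hs : s ^ 2 = 8 := Real.sq_sqrt (by norm_num)
  have h1 := mgf_linear_le hθ hθ1 hx hlaw hind u s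
  have h2 := mgf_linear_le hθ hθ1 hx hlaw hind u (-s)
  have hi := integrable_linear_pow hθ hθ1 hx hlaw hind u 8
  rw [neg_sq] at h2
  rw [hu, hs] at h1 h2
  have e4 : Real.exp (8 * 1 / 2) ≤ 54.6 := by
    have : Real.exp (8 * 1 / 2) = Real.exp 1 ^ 4 := by rw [← Real.exp_nat_mul]; norm_num
    rw [this]
    have := pow_le_pow_left₀ (Real.exp_pos _).le Real.exp_one_lt_d9.le 4
    refine this.trans ?_
    norm_num
  have h3 : ∫ ω, (4096 / 20160) * (∑ i, u i * x i ω) ^ 8 ∂μ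
      ≤ ∫ ω, ((Real.exp (s * ∑ i, u i * x i ω) + Real.exp (-s * ∑ i, u i * x i ω)) - 2) ∂μ := by
    refine integral_mono (hi.const_mul _) ((h1.1.add h2.1).sub (integrable_const 2)) fun ω => ?_
    dsimp only
    have := pow_eight_le_cosh (s * ∑ i, u i * x i ω)
    have e8 : s ^ 8 = 4096 := by
      have : s ^ 8 = (s ^ 2) ^ 4 := by ring
      rw [this, hs]; norm_num
    rw [mul_pow, e8, Real.cosh_eq, ← neg_mul] at this
    linarith
  have h5 : Integrable (fun ω => Real.exp (s * ∑ i, u i * x i ω)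
      + Real.exp (-s * ∑ i, u i * x i ω)) μ := h1.1.add h2.1
  rw [integral_const_mul, integral_sub h5 (integrable_const 2), integral_add h1.1 h2.1] at h3
  simp only [integral_const, probReal_univ, one_smul] at h3
  have h4 : θ * Real.exp (8 * 1 / 2) ≤ θ * 54.6 := mul_le_mul_of_nonneg_left e4 hθ
  have := h1.2
  have := h2.2
  linarith

/-- Write the form as `u_j x_j + y` with `y` independent of `x_j`. In the expanded product the odd
moments of `x_j` vanish, leaving `u_j³ E x_j⁴ + 3 u_j E x_j² E y²`. -/
theorem integral_linear_cube_mul (hθ : 0 ≤ θ) (hθ1 : θ ≤ 1) (hx : ∀ i, Measurable (x i))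
    (hlaw : ∀ i, μ.map (x i) = bernoulliGaussian θ) (hind : iIndepFun x μ) {u : m → ℝ}
    (hu : ∑ i, u i ^ 2 = 1) (j : m) :
    ∫ ω, (∑ i, u i * x i ω) ^ 3 * x j ω ∂μ = 3 * θ * (1 - θ) * u j ^ 3 + 3 * θ ^ 2 * u j := by
  classical
  set w : m → ℝ := fun i => if i = j then 0 else u i with hw
  set y : Ω → ℝ := fun ω => ∑ i, w i * x i ω with hy
  have hym : Measurable y := by fun_prop
  have hsplit : ∀ ω, ∑ i, u i * x i ω = u j * x j ω + y ω := fun ω => by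
    have : ∀ i, u i * x i ω = (if i = j then u j * x j ω else 0) + w i * x i ω := fun i => by
      simp only [hw]
      split_ifs with h
      · subst h; ring
      · ring
    rw [Finset.sum_congr rfl fun i _ => this i, Finset.sum_add_distrib, Finset.sum_ite_eq',
      if_pos (Finset.mem_univ j)]
  have hw2 : ∑ i, w i ^ 2 = 1 - u j ^ 2 := by
    have : ∀ i, w i ^ 2 = u i ^ 2 - if i = j then u j ^ 2 else 0 := fun i => by
      simp only [hw]
      split_ifs with h
      · subst h; ring
      · ring
    rw [Finset.sum_congr rfl fun i _ => this i, Finset.sum_sub_distrib, hu, Finset.sum_ite_eq',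
      if_pos (Finset.mem_univ j)]
  have hindy : IndepFun (x j) y μ := by
    -- The coefficient at `j` is set to `1` so that the `j`-th variable of this family is `x_j`
    -- itself, even when `u j = 0`.
    have hz : iIndepFun (fun i ω => (if i = j then 1 else u i) * x i ω) μ :=
      hind.comp (fun i y => (if i = j then 1 else u i) * y) fun i => measurable_const_mul _
    have h := (hz.indepFun_finsetSum_of_notMem (fun i => (hx i).const_mul _)
      (Finset.notMem_erase j Finset.univ)).symm
    have e1 : (∑ i ∈ Finset.univ.erase j, fun ω => (if i = j then 1 else u i) * x i ω) = y := by
      funext ω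
      simp only [hy]
      rw [Finset.sum_apply, ← Finset.add_sum_erase _ _ (Finset.mem_univ j)]
      simp only [hw, if_true, zero_mul, zero_add]
      refine Finset.sum_congr rfl fun i hi => ?_
      rw [if_neg (Finset.ne_of_mem_erase hi), if_neg (Finset.ne_of_mem_erase hi)]
    rw [e1] at h
    simpa using h
  have hxi := fun k => integrable_pow_of_law (hx j) (hlaw j) k
  have hyi := fun k => integrable_linear_pow hθ hθ1 hx hlaw hind w k
  have hab : ∀ a b : ℕ, IndepFun (fun ω => x j ω ^ a) (fun ω => y ω ^ b) μ := fun a b =>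
    hindy.comp (measurable_id.pow_const a) (measurable_id.pow_const b)
  have hI : ∀ a b : ℕ, Integrable (fun ω => x j ω ^ a * y ω ^ b) μ := fun a b =>
    (hab a b).integrable_mul (hxi a) (hyi b)
  have hE : ∀ a b : ℕ, ∫ ω, x j ω ^ a * y ω ^ b ∂μ = (∫ ω, x j ω ^ a ∂μ) * ∫ ω, y ω ^ b ∂μ :=
    fun a b => (hab a b).integral_fun_mul_eq_mul_integral (hxi a).aestronglyMeasurable
      (hyi b).aestronglyMeasurable
  obtain ⟨m1, m2, m3, m4⟩ := integral_pow_of_law hθ hθ1 (hx j) (hlaw j)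
  have y2 : ∫ ω, y ω ^ 2 ∂μ = θ * (1 - u j ^ 2) := by
    rw [← hw2]; exact integral_linear_sq hθ hθ1 hx hlaw hind w
  have hexp : ∀ ω, (∑ i, u i * x i ω) ^ 3 * x j ω
      = u j ^ 3 * (x j ω ^ 4 * y ω ^ 0) + 3 * u j ^ 2 * (x j ω ^ 3 * y ω ^ 1)
        + (3 * u j * (x j ω ^ 2 * y ω ^ 2) + x j ω ^ 1 * y ω ^ 3) := fun ω => by
    rw [hsplit]; ring
  simp_rw [hexp]
  have i1 := (hI 4 0).const_mul (u j ^ 3)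
  have i2 := (hI 3 1).const_mul (3 * u j ^ 2)
  have i3 := (hI 2 2).const_mul (3 * u j)
  have i4 := hI 1 3
  have i12 : Integrable (fun ω => u j ^ 3 * (x j ω ^ 4 * y ω ^ 0)
    + 3 * u j ^ 2 * (x j ω ^ 3 * y ω ^ 1)) μ := i1.add i2
  have i34 : Integrable (fun ω => 3 * u j * (x j ω ^ 2 * y ω ^ 2) + x j ω ^ 1 * y ω ^ 3) μ :=
    i3.add i4
  rw [integral_add i12 i34, integral_add i1 i2, integral_add i3 i4]
  simp only [integral_const_mul, hE, m2, m3, m4, y2]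
  simp only [pow_one, m1, pow_zero, integral_const, probReal_univ, one_smul]
  ring

/-- Integrability and a bound for the second moment of `(u ⬝ x)³ x_j`. -/
theorem integral_linear_cube_mul_sq_le (hθ : 0 ≤ θ) (hθ1 : θ ≤ 1) (hx : ∀ i, Measurable (x i))
    (hlaw : ∀ i, μ.map (x i) = bernoulliGaussian θ) (hind : iIndepFun x μ) {u : m → ℝ}
    (hu : ∑ i, u i ^ 2 = 1) (j : m) :
    Integrable (fun ω => ((∑ i, u i * x i ω) ^ 3 * x j ω) ^ 2) μ ∧
      Integrable (fun ω => (∑ i, u i * x i ω) ^ 3 * x j ω) μ ∧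
      ∫ ω, ((∑ i, u i * x i ω) ^ 3 * x j ω) ^ 2 ∂μ ≤ 528 * θ := by
  classical
  have hi := integrable_linear_pow hθ hθ1 hx hlaw hind u 8
  have hj := integrable_pow_of_law (hx j) (hlaw j) 8
  have hdom : Integrable (fun ω => 3 / 4 * (∑ i, u i * x i ω) ^ 8 + 1 / 4 * x j ω ^ 8) μ :=
    (hi.const_mul _).add (hj.const_mul _)
  have hle : ∀ ω, ((∑ i, u i * x i ω) ^ 3 * x j ω) ^ 2
      ≤ 3 / 4 * (∑ i, u i * x i ω) ^ 8 + 1 / 4 * x j ω ^ 8 := fun ω => by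
    generalize ∑ i, u i * x i ω = a
    generalize x j ω = b
    have ha := sq_nonneg a
    have hb := sq_nonneg b
    -- Young's inequality `a⁶b² ≤ (3/4)a⁸ + (1/4)b⁸`, with an explicit nonnegative remainder. Both
    -- eighth moments obey the same bound, `x_j` being the unit linear form with `u = e_j`.
    have e : 3 / 4 * a ^ 8 + 1 / 4 * b ^ 8 - (a ^ 3 * b) ^ 2
      = 1 / 4 * (a ^ 2 - b ^ 2) ^ 2 * (3 * (a ^ 2) ^ 2 + 2 * (a ^ 2 * b ^ 2) + (b ^ 2) ^ 2) := by
      ring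
    have : 0 ≤ 1 / 4 * (a ^ 2 - b ^ 2) ^ 2 * (3 * (a ^ 2) ^ 2 + 2 * (a ^ 2 * b ^ 2) + (b ^ 2) ^ 2) := by
      positivity
    linarith
  have hsq : Integrable (fun ω => ((∑ i, u i * x i ω) ^ 3 * x j ω) ^ 2) μ := by
    refine hdom.mono' (by fun_prop) (Filter.Eventually.of_forall fun ω => ?_)
    rw [Real.norm_of_nonneg (by positivity)]
    exact hle ω
  refine ⟨hsq, ((memLp_two_iff_integrable_sq (by fun_prop)).mpr hsq).integrable one_le_two, ?_⟩
  have hej : ∫ ω, x j ω ^ 8 ∂μ ≤ 528 * θ := by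
    have := integral_linear_pow_eight_le hθ hθ1 hx hlaw hind
      (u := fun i => if i = j then 1 else 0) (by simp)
    simpa using this
  have h8 := integral_linear_pow_eight_le hθ hθ1 hx hlaw hind hu
  have := integral_mono hsq hdom hle
  rw [integral_add (hi.const_mul _) (hj.const_mul _), integral_const_mul, integral_const_mul]
    at this
  linarith

end Moments

/-! ### Truncation and concentration of a single entry. -/

section Truncation

open Classical in
/-- The summand `(u ⬝ c)³ c_j`, set to `0` unless all entries of `c` are at most `L`. -/
noncomputable def truncGrad {m : Type*} [Fintype m] (L : ℝ) (u : m → ℝ) (j : m) (c : m → ℝ) : ℝ :=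
  if ∀ l, |c l| ≤ L then (∑ l, u l * c l) ^ 3 * c j else 0

theorem measurable_truncGrad {m : Type*} [Fintype m] (L : ℝ) (u : m → ℝ) (j : m) :
    Measurable (truncGrad L u j) := by
  classical
  refine Measurable.ite ?_ (by fun_prop) measurable_const
  simp only [Set.ofPred_forall]
  exact MeasurableSet.iInter fun l => measurableSet_le (by fun_prop) measurable_const

/-- Cauchy–Schwarz bounds the linear form by `√n L`. This `n^{3/2} L⁴` is the source of `n^{5/2}
(log p)⁴` in the final exponent. -/
theorem abs_truncGrad_le {n : ℕ} {L : ℝ} (hL : 0 ≤ L) {u : Fin n → ℝ} (hu : ∑ l, u l ^ 2 = 1)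
    (j : Fin n) (c : Fin n → ℝ) : |truncGrad L u j c| ≤ √n ^ 3 * L ^ 4 := by
  unfold truncGrad
  split_ifs with h
  · have h1 : |∑ l, u l * c l| ≤ √n * L := by
      refine abs_le_of_sq_le_sq ?_ (by positivity)
      refine (Finset.sum_mul_sq_le_sq_mul_sq _ _ _).trans ?_
      rw [hu, one_mul, mul_pow, Real.sq_sqrt (Nat.cast_nonneg n)]
      calc ∑ l, c l ^ 2 ≤ ∑ _l : Fin n, L ^ 2 := Finset.sum_le_sum fun l _ =>
            sq_le_sq.mpr (by rw [abs_of_nonneg hL]; exact h l)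
        _ = n * L ^ 2 := by simp
    rw [abs_mul, abs_pow]
    calc |∑ l, u l * c l| ^ 3 * |c j| ≤ (√n * L) ^ 3 * L := by
          gcongr
          exact h j
      _ = _ := by ring
  · simp; positivity

variable {Ω : Type*} [MeasurableSpace Ω] {μ : Measure Ω} [IsProbabilityMeasure μ] {θ : ℝ} {n : ℕ}

theorem integral_truncGrad_sq_le (hθ : 0 ≤ θ) (hθ1 : θ ≤ 1) {x : Fin n → Ω → ℝ}
    (hx : ∀ i, Measurable (x i)) (hlaw : ∀ i, μ.map (x i) = bernoulliGaussian θ)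
    (hind : iIndepFun x μ) {u : Fin n → ℝ} (hu : ∑ i, u i ^ 2 = 1) (j : Fin n) (L : ℝ) :
    ∫ ω, truncGrad L u j (fun i => x i ω) ^ 2 ∂μ ≤ 528 * θ := by
  obtain ⟨h1, -, h3⟩ := integral_linear_cube_mul_sq_le hθ hθ1 hx hlaw hind hu j
  refine le_trans (integral_mono_of_nonneg (Filter.Eventually.of_forall fun ω => sq_nonneg _) h1
    (Filter.Eventually.of_forall fun ω => ?_)) h3
  dsimp only [truncGrad]
  split_ifs
  · rfl
  · simp only [ne_eq, OfNat.ofNat_ne_zero, not_false_eq_true, zero_pow]; positivity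

/-- The bias lives on the event that some entry exceeds `L`, of probability at most `2nθ s²` with `s
= exp(-L²/4)`. There `|Y| ≤ (s/2) Y² + 1/(2s)`, and the two terms integrate to at most `264 θ s` and
`n θ s`. -/
theorem abs_integral_truncGrad_sub_le (hθ : 0 ≤ θ) (hθ1 : θ ≤ 1) {x : Fin n → Ω → ℝ}
    (hx : ∀ i, Measurable (x i)) (hlaw : ∀ i, μ.map (x i) = bernoulliGaussian θ)
    (hind : iIndepFun x μ) {u : Fin n → ℝ} (hu : ∑ i, u i ^ 2 = 1) (j : Fin n) {L : ℝ}
    (hL : 0 ≤ L) :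
    |∫ ω, truncGrad L u j (fun i => x i ω) ∂μ
        - (3 * θ * (1 - θ) * u j ^ 3 + 3 * θ ^ 2 * u j)|
      ≤ (264 + n) * θ * Real.exp (-(L ^ 2 / 4)) := by
  classical
  obtain ⟨h1, h2, h3⟩ := integral_linear_cube_mul_sq_le hθ hθ1 hx hlaw hind hu j
  rw [← integral_linear_cube_mul hθ hθ1 hx hlaw hind hu j]
  have hZi : Integrable (fun ω => truncGrad L u j (fun i => x i ω)) μ :=
    Integrable.of_bound ((measurable_truncGrad L u j).comp
      (measurable_pi_lambda _ hx)).aestronglyMeasurable _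
      (Filter.Eventually.of_forall fun ω => abs_truncGrad_le hL hu j _)
  rw [← integral_sub hZi h2]
  set bad : Set Ω := ⋃ i, {ω | L < |x i ω|} with hbad
  have hbm : MeasurableSet bad :=
    MeasurableSet.iUnion fun i => measurableSet_lt measurable_const (by fun_prop)
  have hpb : μ.real bad ≤ n * (2 * θ * Real.exp (-(L ^ 2 / 2))) := by
    refine (measureReal_iUnion_fintype_le _).trans ?_
    refine (Finset.sum_le_sum fun i _ => measure_abs_gt_le hθ (hx i) (hlaw i) hL).trans ?_
    simp
  set s := Real.exp (-(L ^ 2 / 4)) with hs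
  have hs0 : 0 < s := Real.exp_pos _
  have hss : Real.exp (-(L ^ 2 / 2)) = s * s := by rw [hs, ← Real.exp_add]; congr 1; ring
  have hind_int : Integrable (bad.indicator fun _ => (1 : ℝ)) μ :=
    (integrable_const 1).indicator hbm
  have hdom : Integrable (fun ω => s / 2 * ((∑ i, u i * x i ω) ^ 3 * x j ω) ^ 2
      + 1 / (2 * s) * bad.indicator (fun _ => (1 : ℝ)) ω) μ :=
    (h1.const_mul _).add (hind_int.const_mul _)
  have hle : ∀ ω, ‖truncGrad L u j (fun i => x i ω) - (∑ i, u i * x i ω) ^ 3 * x j ω‖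
      ≤ s / 2 * ((∑ i, u i * x i ω) ^ 3 * x j ω) ^ 2
        + 1 / (2 * s) * bad.indicator (fun _ => (1 : ℝ)) ω := fun ω => by
    unfold truncGrad
    split_ifs with h
    · rw [sub_self, norm_zero]
      have : 0 ≤ bad.indicator (fun _ => (1 : ℝ)) ω :=
        Set.indicator_nonneg (fun _ _ => zero_le_one) ω
      positivity
    · have hω : ω ∈ bad := by
        push Not at h
        obtain ⟨i, hi⟩ := h
        exact Set.mem_iUnion.mpr ⟨i, hi⟩
      rw [Set.indicator_of_mem hω, zero_sub, norm_neg, Real.norm_eq_abs]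
      generalize (∑ i, u i * x i ω) ^ 3 * x j ω = y
      rw [← sq_abs y]
      generalize |y| = y
      have : s / 2 * y ^ 2 + 1 / (2 * s) * 1 - y = (s * y - 1) ^ 2 / (2 * s) := by
        field_simp; ring
      have : 0 ≤ (s * y - 1) ^ 2 / (2 * s) := by positivity
      linarith
  rw [← Real.norm_eq_abs]
  refine (norm_integral_le_of_norm_le hdom (Filter.Eventually.of_forall hle)).trans ?_
  rw [integral_add (h1.const_mul _) (hind_int.const_mul _), integral_const_mul, integral_const_mul,
    integral_indicator_const _ hbm, smul_eq_mul, mul_one]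
  rw [hss] at hpb
  calc s / 2 * ∫ ω, ((∑ i, u i * x i ω) ^ 3 * x j ω) ^ 2 ∂μ + 1 / (2 * s) * μ.real bad
      ≤ s / 2 * (528 * θ) + 1 / (2 * s) * (n * (2 * θ * (s * s))) := by gcongr
    _ = _ := by field_simp; ring

/-- On the event that all entries are at most `L`, the entries of `∑ₖ (Vₖ xₖ)^{∘3} xₖᵀ` are
concentrated around their expectations. -/
theorem entry_tail {κ : Type*} [Fintype κ] {X : Ω → Matrix (Fin n) κ ℝ} (hθ : 0 ≤ θ) (hθ1 : θ ≤ 1)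
    (hX : IsBernoulliGaussianMatrix μ θ X) {V : κ → Matrix (Fin n) (Fin n) ℝ}
    (hV : ∀ k, V k ∈ Matrix.orthogonalGroup (Fin n) ℝ) (i j : Fin n) {L t : ℝ} (hL : 0 < L)
    (ht : 0 < t) :
    μ.real {ω | (∀ a k, |X ω a k| ≤ L) ∧
        t + Fintype.card κ * ((264 + n) * θ * Real.exp (-(L ^ 2 / 4)))
          ≤ |∑ k, (∑ l, V k i l * X ω l k) ^ 3 * X ω j k - ∑ k, meanGrad θ (V k) i j|}
      ≤ 2 * Real.exp (-(t ^ 2 / (4 * Fintype.card κ * (528 * θ) + 2 * (√n ^ 3 * L ^ 4) * t))) := by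
  have hn : 0 < n := i.pos
  have hmeas := hX.measurable_entry
  have hcol := iIndepFun_columns (X := fun j k ω => X ω j k) hmeas hX.indep
  have hrow : ∀ k, iIndepFun (fun j ω => X ω j k) μ := fun k =>
    hX.indep.precomp (g := fun j : Fin n => (j, k)) fun a b h => (Prod.mk.inj h).1
  have hu := fun k => orthogonal_row_sq (hV k) i
  have hZ : iIndepFun (fun k ω => truncGrad L (V k i) j fun l => X ω l k) μ :=
    hcol.comp (fun k => truncGrad L (V k i) j) fun k => measurable_truncGrad _ _ _
  have hb := bernstein_abs_ge (M := √n ^ 3 * L ^ 4) (v := 528 * θ) (t := t) hZ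
    (fun k => (measurable_truncGrad _ _ _).comp (measurable_pi_lambda _ fun l => hmeas l k))
    (fun k ω => abs_truncGrad_le hL.le (hu k) j _)
    (fun k => integral_truncGrad_sq_le hθ hθ1 (fun l => hmeas l k) (fun l => hX.law_entry l k)
      (hrow k) (hu k) j L)
    (by positivity) (by positivity) ht
  refine (measureReal_mono ?_).trans hb
  rintro ω ⟨h1, h2⟩
  have e : ∀ k, truncGrad L (V k i) j (fun l => X ω l k)
      = (∑ l, V k i l * X ω l k) ^ 3 * X ω j k := fun k => if_pos fun l => h1 l k
  have hbias : |∑ k, ∫ ω, truncGrad L (V k i) j (fun l => X ω l k) ∂μ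
      - ∑ k, meanGrad θ (V k) i j|
      ≤ Fintype.card κ * ((264 + n) * θ * Real.exp (-(L ^ 2 / 4))) := by
    rw [← Finset.sum_sub_distrib]
    refine (Finset.abs_sum_le_sum_abs _ _).trans ?_
    refine (Finset.sum_le_sum fun k _ => abs_integral_truncGrad_sub_le hθ hθ1 (fun l => hmeas l k)
      (fun l => hX.law_entry l k) (hrow k) (hu k) j hL.le).trans (le_of_eq ?_)
    simp
  simp only [Set.mem_ofPred_eq, e]
  have := abs_sub_le (∑ k, (∑ l, V k i l * X ω l k) ^ 3 * X ω j k)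
    (∑ k, ∫ ω, truncGrad L (V k i) j (fun l => X ω l k) ∂μ) (∑ k, meanGrad θ (V k) i j)
  linarith

/-- All entries are at most `L` with high probability. -/
theorem measure_exists_entry_gt_le {κ : Type*} [Fintype κ] {X : Ω → Matrix (Fin n) κ ℝ}
    (hθ : 0 ≤ θ) (hX : IsBernoulliGaussianMatrix μ θ X) {L : ℝ} (hL : 0 ≤ L) :
    μ.real {ω | ∀ a k, |X ω a k| ≤ L}ᶜ
      ≤ 2 * n * Fintype.card κ * θ * Real.exp (-(L ^ 2 / 2)) := by
  have hsub : {ω | ∀ a k, |X ω a k| ≤ L}ᶜ ⊆ ⋃ e : Fin n × κ, {ω | L < |X ω e.1 e.2|} := by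
    intro ω hω
    simp only [Set.mem_compl_iff, Set.mem_ofPred_eq] at hω
    push Not at hω
    obtain ⟨a, k, h⟩ := hω
    exact Set.mem_iUnion.mpr ⟨(a, k), h⟩
  refine (measureReal_mono hsub).trans ((measureReal_iUnion_fintype_le _).trans ?_)
  refine (Finset.sum_le_sum fun e _ => measure_abs_gt_le hθ (hX.measurable_entry e.1 e.2)
    (hX.law_entry e.1 e.2) hL).trans (le_of_eq ?_)
  simp
  ring

end Truncation

/-! ### Deterministic perturbation estimate and numerical constants. -/

theorem cubicGrad_apply {n : ℕ} {κ : Type*} [Fintype κ] (U : Matrix (Fin n) (Fin n) ℝ)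
    (X : Matrix (Fin n) κ ℝ) (i j : Fin n) :
    cubicGrad U X i j = ∑ k, (∑ l, U i l * X l k) ^ 3 * X j k := by
  simp [cubicGrad, Matrix.mul_apply]

theorem sum_cubicGrad_localBlock_apply {n N : ℕ} {q : Fin N → ℕ}
    (V : Fin N → Matrix (Fin n) (Fin n) ℝ) (X : Matrix (Fin n) (Σ i, Fin (q i)) ℝ) (i j : Fin n) :
    (∑ a, cubicGrad (V a) (localBlock X a)) i j
      = ∑ k : Σ i, Fin (q i), (∑ l, V k.1 i l * X l k) ^ 3 * X j k := by
  simp [Matrix.sum_apply, cubicGrad_apply, localBlock, Fintype.sum_sigma]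

/-- The deterministic part: if both gradients are close to their expectations, then the relative
gap is small. -/
theorem ratio_lt_of_near_mean {n N : ℕ} (hn : 0 < n) {q : Fin N → ℕ} {p θ α ε δ : ℝ}
    {U P B S : Matrix (Fin n) (Fin n) ℝ} {V : Fin N → Matrix (Fin n) (Fin n) ℝ}
    (hp : p = ∑ i, (q i : ℝ)) (hp0 : 0 < p) (hθ : 0 < θ) (hθα : θ < α) (hα : α < 1)
    (hU : U ∈ Matrix.orthogonalGroup (Fin n) ℝ) (hV : ∀ i, V i ∈ Matrix.orthogonalGroup (Fin n) ℝ)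
    (hP : IsSignedPermutation P) (hUP : ‖U - P‖ ≤ ε) (hVP : ∀ i, ‖V i - P‖ ≤ ε) (hε : ε ≤ 1)
    (hUV : ∀ i, ‖U - V i‖ ≤ δ) (hδ : 0 < δ) (hC : 0 < gapConst n α θ ε)
    (hB : ‖B - p • meanGrad θ U‖ < p * (δ * gapConst n α θ ε / (2 * (δ + 2))))
    (hS : ‖S - ∑ i, (q i : ℝ) • meanGrad θ (V i)‖
      < p * (δ * gapConst n α θ ε / (2 * (δ + 2)))) :
    0 < sigmaMin B + sigmaMin S ∧ 2 * ‖B - S‖ / (sigmaMin B + sigmaMin S) < α * δ := by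
  have hε0 : 0 ≤ ε := (norm_nonneg _).trans hUP
  have hθ1 : θ ≤ 1 := by linarith
  have hα0 : 0 < α := by linarith
  set C := gapConst n α θ ε with hCdef
  set τ := δ * C / (2 * (δ + 2)) with hτ
  set a := 3 * θ * (1 - θ) with ha
  set b := 3 * θ ^ 2 with hb
  have ha0 : 0 ≤ a := mul_nonneg (by positivity) (by linarith)
  have hb0 : 0 < b := by positivity
  have hCe : C = 2 * α * a * (1 - 2 * n * ε) - 2 * (1 - α) * b - 2 * α * b * ε
      - 6 * √2 * (α + 1) * a * ε := by
    rw [hCdef, gapConst, ha, hb]; ring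
  have wsum : ∀ (F : Fin N → Matrix (Fin n) (Fin n) ℝ) (r : ℝ), (∀ i, ‖F i‖ ≤ r) →
      ‖∑ i, (q i : ℝ) • F i‖ ≤ p * r := fun F r hF => by
    rw [hp, Finset.sum_mul]
    refine (norm_sum_le _ _).trans (Finset.sum_le_sum fun i _ => ?_)
    rw [norm_smul, Real.norm_of_nonneg (Nat.cast_nonneg _)]
    exact mul_le_mul_of_nonneg_left (hF i) (Nat.cast_nonneg _)
  have s1 : p * (a + b) - p * τ - p * (a * (3 * ε) + b * ε) < sigmaMin B := by
    have h1 := sub_norm_le_sigmaMin hn hP B (s := p * (a + b)) (by positivity)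
    have h2 : B - (p * (a + b)) • P
        = (B - p • meanGrad θ U) + p • (meanGrad θ U - (a + b) • P) := by module
    have h3 := norm_add_le (B - p • meanGrad θ U) (p • (meanGrad θ U - (a + b) • P))
    rw [← h2, norm_smul, Real.norm_of_nonneg hp0.le] at h3
    have h4 := mul_le_mul_of_nonneg_left
      (norm_meanGrad_sub_signedPermutation_le hθ.le hθ1 hU hP hUP) hp0.le
    linarith
  have s2 : p * (a + b) - p * τ - p * (a * (3 * ε) + b * ε) < sigmaMin S := by
    have h1 := sub_norm_le_sigmaMin hn hP S (s := p * (a + b)) (by positivity)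
    have h2 : S - (p * (a + b)) • P = (S - ∑ i, (q i : ℝ) • meanGrad θ (V i))
        + ∑ i, (q i : ℝ) • (meanGrad θ (V i) - (a + b) • P) := by
      simp only [smul_sub, Finset.sum_sub_distrib, ← Finset.sum_smul, ← hp]
      module
    have h3 := norm_add_le (S - ∑ i, (q i : ℝ) • meanGrad θ (V i))
      (∑ i, (q i : ℝ) • (meanGrad θ (V i) - (a + b) • P))
    rw [← h2] at h3
    have h4 := wsum _ _ fun i =>
      norm_meanGrad_sub_signedPermutation_le hθ.le hθ1 (hV i) hP (hVP i)
    linarith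
  have s3 : ‖B - S‖ < 2 * (p * τ) + p * ((a * (3 * √2 * ε) + b) * δ) := by
    have h2 : B - S = (B - p • meanGrad θ U) - (S - ∑ i, (q i : ℝ) • meanGrad θ (V i))
        + ∑ i, (q i : ℝ) • (meanGrad θ U - meanGrad θ (V i)) := by
      simp only [smul_sub, Finset.sum_sub_distrib, ← Finset.sum_smul, ← hp]
      module
    have h3 := norm_add_le ((B - p • meanGrad θ U) - (S - ∑ i, (q i : ℝ) • meanGrad θ (V i)))
      (∑ i, (q i : ℝ) • (meanGrad θ U - meanGrad θ (V i)))
    have h3' := norm_sub_le (B - p • meanGrad θ U) (S - ∑ i, (q i : ℝ) • meanGrad θ (V i))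
    rw [← h2] at h3
    have h4 := wsum (fun i => meanGrad θ U - meanGrad θ (V i)) ((a * (3 * √2 * ε) + b) * δ)
      fun i => (norm_meanGrad_sub_meanGrad_le hθ.le hθ1 hU (hV i) hP hUP (hVP i) hε).trans
        (mul_le_mul_of_nonneg_left (hUV i) (by positivity))
    linarith
  -- The total cost of the random errors: `4τ` from the numerator, `2αδτ` from the denominator. The
  -- choice of `τ` makes `2(δ+2)τ = δC`, and `α < 1` suffices.
  have hτ2 : 4 * τ + 2 * (α * δ) * τ ≤ δ * C := by
    have h1 : 2 * (δ + 2) * τ = δ * C := by rw [hτ]; field_simp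
    have h2 : 0 < τ := by rw [hτ]; positivity
    have h3 : α * δ * τ ≤ 1 * δ * τ := by gcongr
    linarith
  have hsq : 1 ≤ √2 := Real.one_le_sqrt.mpr (by norm_num)
  -- The right side exceeds `C` by exactly `a ε α (4n + 6(√2 - 1))`.
  have hgap : C ≤ α * (2 * (a + b) - 2 * (a * (3 * ε) + b * ε)) - 2 * (a * (3 * √2 * ε) + b) := by
    have h0 : 0 ≤ a * ε * α * (4 * n + 6 * (√2 - 1)) := by
      have : (0 : ℝ) ≤ √2 - 1 := by linarith
      positivity
    rw [hCe]
    linarith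
  have main : 2 * ‖B - S‖ < α * δ * (sigmaMin B + sigmaMin S) := by
    have h1 : α * δ * (2 * (p * (a + b) - p * τ - p * (a * (3 * ε) + b * ε)))
        ≤ α * δ * (sigmaMin B + sigmaMin S) :=
      mul_le_mul_of_nonneg_left (by linarith) (by positivity)
    have h2 := mul_le_mul_of_nonneg_left (mul_le_mul_of_nonneg_left hgap hδ.le) hp0.le
    have h3 := mul_le_mul_of_nonneg_left hτ2 hp0.le
    linarith
  -- Positivity is free: `main` places the sum strictly above a nonnegative quantity after scaling
  -- by `αδ > 0`.
  have hpos : 0 < sigmaMin B + sigmaMin S := by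
    by_contra hneg
    have h1 : α * δ * (sigmaMin B + sigmaMin S) ≤ 0 :=
      mul_nonpos_of_nonneg_of_nonpos (by positivity) (not_lt.mp hneg)
    have := norm_nonneg (B - S)
    linarith
  exact ⟨hpos, (div_lt_iff₀ hpos).mpr main⟩

/-- The hypothesis on `ε` makes `ε` small and the constant `C` positive. -/
theorem gapConst_pos {n : ℕ} (hn : 0 < n) {θ α ε : ℝ} (hθ : 0 < θ) (hα : α ∈ Set.Ioo θ 1)
    (hε : ε ∈ Set.Ico 0 ((α - θ) /
          (2 * α * n * (1 - θ) + 3 * √2 * (1 + α) * (1 - θ) + α * θ))) :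
    ε ≤ 1 ∧ 0 < gapConst n α θ ε ∧ gapConst n α θ ε ≤ 6 := by
  obtain ⟨hα1, hα2⟩ := hα
  obtain ⟨hε0, hε1⟩ := hε
  have hα0 : 0 < α := hθ.trans hα1
  have hθ1 : 0 < 1 - θ := by linarith
  have hn1 : (1 : ℝ) ≤ n := by exact_mod_cast hn
  have hs : (0 : ℝ) ≤ √2 := Real.sqrt_nonneg 2
  have hden : 0 < 2 * α * n * (1 - θ) + 3 * √2 * (1 + α) * (1 - θ) + α * θ := by positivity
  rw [lt_div_iff₀ hden] at hε1
  have hC : 0 < gapConst n α θ ε := by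
    -- The upper limit imposed on `ε` is exactly the condition `C > 0`.
    have : gapConst n α θ ε = 6 * θ * (α - θ
        - ε * (2 * α * n * (1 - θ) + 3 * √2 * (1 + α) * (1 - θ) + α * θ)) := by
      unfold gapConst; ring
    rw [this]
    exact mul_pos (by positivity) (by linarith)
  refine ⟨?_, hC, ?_⟩
  · by_contra h
    push Not at h
    have h1 : α * (1 - θ) ≤ 2 * α * n * (1 - θ) := by
      have : α * (1 - θ) * 1 ≤ α * (1 - θ) * (2 * n) := by gcongr; linarith
      linarith
    have h2 : 0 ≤ 3 * √2 * (1 + α) * (1 - θ) := by positivity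
    have h3 : 0 < α * θ := by positivity
    nlinarith
  · unfold gapConst
    have e1 : 0 ≤ 6 * (1 - α) * θ ^ 2 := mul_nonneg (by linarith) (by positivity)
    have e2 : 0 ≤ 6 * α * θ ^ 2 * ε := by positivity
    have e3 : 0 ≤ 18 * √2 * (α + 1) * θ * (1 - θ) * ε := by positivity
    have e4 : 0 ≤ 12 * α * θ * (1 - θ) * n * ε := by positivity
    have e5 : α * (θ * (1 - θ)) ≤ 1 * (1 * 1) := by gcongr <;> linarith
    nlinarith

/-- The truncation bias is negligible for the required sample size. -/
theorem bias_le {n p : ℕ} (hp : 2 ≤ p) {θ δ C : ℝ} (hθ : 0 < θ) (hθ1 : θ ≤ 1)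
    (hδ : 0 < δ) (hC : 0 < C) (hC6 : C ≤ 6) (hn : 0 < n)
    (h : 10 ^ 6 * ((δ + 2) / (δ * C) * n) ≤ p / Real.log p ^ 4) :
    (264 + n) * θ * Real.exp (-(Real.log p ^ 2 / 4)) ≤ δ * C / (8 * (δ + 2) * n) := by
  have hp2 : (2 : ℝ) ≤ p := by exact_mod_cast hp
  have hp0 : (0 : ℝ) < p := by linarith
  have hn0 : (0 : ℝ) < n := by exact_mod_cast hn
  have hpe : (p : ℝ) = Real.exp (Real.log p) := (Real.exp_log hp0).symm
  have hL : 0.69 ≤ Real.log p := by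
    have h1 := Real.log_le_log (by norm_num) hp2
    have h2 := Real.log_two_gt_d9
    linarith
  set L := Real.log p
  have hL4 : 0.226 ≤ L ^ 4 := by
    refine le_trans ?_ (pow_le_pow_left₀ (by norm_num) hL 4)
    norm_num
  have hL40 : 0 < L ^ 4 := by linarith
  rw [le_div_iff₀ hL40] at h
  set r := δ * C / ((δ + 2) * n) with hr
  have hr0 : 0 < r := by positivity
  have hrinv : (δ + 2) / (δ * C) * n = 1 / r := by rw [hr]; field_simp
  rw [hrinv] at h
  have hK : 10 ^ 6 * L ^ 4 ≤ p * r := by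
    have := mul_le_mul_of_nonneg_right h hr0.le
    have e : 10 ^ 6 * (1 / r) * L ^ 4 * r = 10 ^ 6 * L ^ 4 := by field_simp
    linarith
  have hrn : r * n ≤ 6 := by
    have e : r * n = C * (δ / (δ + 2)) := by rw [hr]; field_simp
    have : δ / (δ + 2) ≤ 1 := (div_le_one (by positivity)).mpr (by linarith)
    rw [e]
    nlinarith
  -- Multiplying the sample-size condition `10⁶ L⁴ ≤ p r` by `n` and using `r n ≤ 6` gives much more
  -- than this.
  have hnp : (n : ℝ) ≤ p := by
    have h1 := mul_le_mul_of_nonneg_right hK hn0.le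
    have h2 : p * (r * n) ≤ p * 6 := by gcongr
    have h3 : 0.226 * (n : ℝ) ≤ L ^ 4 * n := by gcongr
    nlinarith
  -- With `p = exp L`, the exponent is `2L - L²/4 = 4 - (L-4)²/4 ≤ 4`. Then `265 · 55` is below `10⁶
  -- · 0.226 / 8`, which is what fixes the size of `K`.
  have hexp : p * (p * Real.exp (-(L ^ 2 / 4))) ≤ 55 := by
    have e1 : p * (p * Real.exp (-(L ^ 2 / 4))) = Real.exp (L + (L + -(L ^ 2 / 4))) := by
      rw [Real.exp_add, Real.exp_add, ← hpe]
    rw [e1]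
    have e2 : L + (L + -(L ^ 2 / 4)) ≤ (4 : ℕ) * 1 := by
      push_cast; nlinarith [sq_nonneg (L - 4)]
    refine (Real.exp_le_exp.mpr e2).trans ?_
    rw [Real.exp_nat_mul]
    refine (pow_le_pow_left₀ (Real.exp_pos _).le Real.exp_one_lt_d9.le 4).trans ?_
    norm_num
  have e3 : δ * C / (8 * (δ + 2) * n) = r / 8 := by rw [hr]; field_simp
  rw [e3]
  refine le_of_mul_le_mul_left ?_ hp0
  have hE := Real.exp_pos (-(L ^ 2 / 4))
  calc p * ((264 + n) * θ * Real.exp (-(L ^ 2 / 4)))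
      ≤ p * ((264 * p + p) * 1 * Real.exp (-(L ^ 2 / 4))) := by
        gcongr
        nlinarith
    _ = 265 * (p * (p * Real.exp (-(L ^ 2 / 4)))) := by ring
    _ ≤ p * (r / 8) := by linarith

/-- Substituting `t` turns `4 · 528` into `4 · 528 · 64/3 = 45056`, which the assumed lower bound on
`c` exceeds; the linear term gets exactly the coefficient `16`. -/
theorem bernstein_exponent_le {n p θ δ C c L : ℝ} (hn : 0 < n) (hp : 0 < p) (hθ : 0 < θ)
    (hδ : 0 < δ) (hC : 0 < C) (hL : 0 < L) (hc : 6.8 * 10 ^ 4 < c) {t : ℝ}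
    (ht : t = 3 * p * δ * C / (8 * n * (δ + 2))) :
    Real.exp (-(t ^ 2 / (4 * p * (528 * θ) + 2 * (√n ^ 3 * L ^ 4) * t)))
      ≤ Real.exp (-3 * p * δ ^ 2 * C ^ 2 / (c * (δ + 2) ^ 2 * n ^ 2 * θ
        + 16 * n ^ (5 / 2 : ℝ) * L ^ 4 * δ * (δ + 2) * C)) := by
  have hpow : n ^ (5 / 2 : ℝ) = n * √n ^ 3 := by
    have e : (5 / 2 : ℝ) = 1 + 1 / 2 * (3 : ℕ) := by norm_num
    rw [e, Real.rpow_add hn, Real.rpow_one, Real.rpow_mul_natCast hn.le, ← Real.sqrt_eq_rpow]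
  have hs : 0 < √n := Real.sqrt_pos.mpr hn
  rw [hpow]
  set R := √n ^ 3
  have hR : 0 < R := by positivity
  apply Real.exp_le_exp.mpr
  rw [neg_mul, neg_mul, neg_mul, neg_div, neg_le_neg_iff]
  have e : t ^ 2 / (4 * p * (528 * θ) + 2 * (R * L ^ 4) * t)
      = 3 * p * δ ^ 2 * C ^ 2 / (45056 * (δ + 2) ^ 2 * n ^ 2 * θ
        + 16 * (n * R) * L ^ 4 * δ * (δ + 2) * C) := by
    rw [ht]; field_simp; ring
  rw [e]
  gcongr
  linarith

/-! ### Union bound and conclusion. -/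

theorem theorem3 :
    ∃ K : ℝ, 0 < K ∧
      ∀ {Ω : Type*} [MeasurableSpace Ω] (μ : Measure Ω) [IsProbabilityMeasure μ]
        (n N : ℕ) (q : Fin N → ℕ) (p : ℕ) (θ α ε δ C c₂ : ℝ)
        (D P A : Matrix (Fin n) (Fin n) ℝ) (Aloc : Fin N → Matrix (Fin n) (Fin n) ℝ)
        (X : Ω → Matrix (Fin n) (Σ i, Fin (q i)) ℝ),
        -- the model
        p = ∑ i, q i → 2 ≤ p → 0 < θ → α ∈ Set.Ioo θ 1 →
        IsBernoulliGaussianMatrix μ θ X →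
        D ∈ Matrix.orthogonalGroup (Fin n) ℝ →
        A ∈ Matrix.orthogonalGroup (Fin n) ℝ →
        (∀ i, Aloc i ∈ Matrix.orthogonalGroup (Fin n) ℝ) →
        -- the dictionaries are close to a common signed permutation of the true one
        IsSignedPermutation P →
        ε ∈ Set.Ico 0 ((α - θ) /
          (2 * α * n * (1 - θ) + 3 * √2 * (1 + α) * (1 - θ) + α * θ)) →
        ‖A * D - P‖ ≤ ε →
        (∀ i, ‖Aloc i * D - P‖ ≤ ε) →
        δ = deviation A Aloc → 0 < δ →
        C = gapConst n α θ ε →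
        (6.8 * 10 ^ 4 : ℝ) < c₂ →
        -- the sample size is large enough
        K * ((δ + 2) / (δ * C) * n) ≤ p / Real.log p ^ 4 →
        1 - 8 * n * p * θ * Real.exp (-(Real.log p ^ 2 / 2))
          - 8 * (n : ℝ) ^ 2 * Real.exp (-3 * p * δ ^ 2 * C ^ 2 /
              (c₂ * (δ + 2) ^ 2 * (n : ℝ) ^ 2 * θ
                + 16 * (n : ℝ) ^ (5 / 2 : ℝ) * Real.log p ^ 4 * δ * (δ + 2) * C))
        ≤ μ.real {ω |
            0 < sigmaMin (cubicGrad (A * D) (X ω))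
                + sigmaMin (∑ i, cubicGrad (Aloc i * D) (localBlock (X ω) i)) ∧
            2 * ‖cubicGrad (A * D) (X ω)
                  - ∑ i, cubicGrad (Aloc i * D) (localBlock (X ω) i)‖ /
              (sigmaMin (cubicGrad (A * D) (X ω))
                + sigmaMin (∑ i, cubicGrad (Aloc i * D) (localBlock (X ω) i))) < α * δ} := by
  refine ⟨10 ^ 6, by norm_num, ?_⟩
  intro Ω _ μ _ n N q p θ α ε δ C c₂ D P A Aloc X hp hp2 hθ hα hX hD hA hAloc hP hε hUP hVP hδdef hδ
    hCdef hc₂ hK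
  -- For `n = 0` all matrices coincide, so the deviation would vanish, against `δ > 0`.
  have hn : 0 < n := by
    rcases Nat.eq_zero_or_pos n with rfl | h
    · have h0 : deviation A Aloc = 0 := by
        unfold deviation
        rw [show (fun i => ‖A - Aloc i‖) = fun _ => 0 from funext fun i => by
          rw [Subsingleton.elim (A - Aloc i) 0, norm_zero]]
        simp
      linarith
    · exact h
  have hθ1 : θ ≤ 1 := (hα.1.trans hα.2).le
  obtain ⟨hε1, hC, hC6⟩ := gapConst_pos hn hθ hα hε
  set L := Real.log p with hL
  have hp2' : (2 : ℝ) ≤ p := by exact_mod_cast hp2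
  have hp0 : (0 : ℝ) < p := by linarith
  have hn0 : (0 : ℝ) < n := by exact_mod_cast hn
  have hL0 : 0 < L := Real.log_pos (by linarith)
  have hU : A * D ∈ Matrix.orthogonalGroup (Fin n) ℝ := mul_mem hA hD
  have hV : ∀ i, Aloc i * D ∈ Matrix.orthogonalGroup (Fin n) ℝ := fun i => mul_mem (hAloc i) hD
  have hUV : ∀ i, ‖A * D - Aloc i * D‖ ≤ δ := fun i => by
    rw [← sub_mul, norm_mul_orthogonal_right _ hD, hδdef]
    exact le_ciSup (f := fun i => ‖A - Aloc i‖) (Set.finite_range _).bddAbove i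
  have hcard : (Fintype.card (Σ i, Fin (q i)) : ℝ) = p := by
    rw [hp]; simp
  have hpq : (p : ℝ) = ∑ i, (q i : ℝ) := by rw [hp]; push_cast; rfl
  rw [← hCdef] at hC hC6
  have hbias := bias_le hp2 hθ hθ1 hδ hC hC6 hn hK
  rw [← hL] at hbias
  set t : ℝ := 3 * p * δ * C / (8 * n * (δ + 2)) with ht
  have ht0 : 0 < t := by positivity
  set r : ℝ := p * (δ * C / (2 * (δ + 2))) / n with hr
  -- The error `r` allowed per entry is split: three quarters for the fluctuation `t`, one quarter
  -- for the bias.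
  have htr : t + p * ((264 + n) * θ * Real.exp (-(L ^ 2 / 4))) ≤ r := by
    have h1 := mul_le_mul_of_nonneg_left hbias hp0.le
    have h2 : r = t + p * (δ * C / (8 * (δ + 2) * n)) := by
      rw [hr, ht]; field_simp; norm_num
    linarith
  set E := Real.exp (-3 * p * δ ^ 2 * C ^ 2 / (c₂ * (δ + 2) ^ 2 * (n : ℝ) ^ 2 * θ
                + 16 * (n : ℝ) ^ (5 / 2 : ℝ) * L ^ 4 * δ * (δ + 2) * C)) with hE
  have hE0 : 0 ≤ E := (Real.exp_pos _).le
  have tail : ∀ W : (Σ i, Fin (q i)) → Matrix (Fin n) (Fin n) ℝ,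
      (∀ k, W k ∈ Matrix.orthogonalGroup (Fin n) ℝ) → ∀ e : Fin n × Fin n,
      μ.real {ω | (∀ a k, |X ω a k| ≤ L) ∧
        r ≤ |∑ k, (∑ l, W k e.1 l * X ω l k) ^ 3 * X ω e.2 k - ∑ k, meanGrad θ (W k) e.1 e.2|}
        ≤ 2 * E := fun W hW e => by
    have h1 := entry_tail hθ.le hθ1 hX hW e.1 e.2 hL0 ht0
    rw [hcard] at h1
    have h2 := bernstein_exponent_le hn0 hp0 hθ hδ hC hL0 hc₂ ht
    refine (measureReal_mono ?_).trans (h1.trans (by linarith))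
    exact fun ω hω => ⟨hω.1, htr.trans hω.2⟩
  set bad : ((Σ i, Fin (q i)) → Matrix (Fin n) (Fin n) ℝ) → Fin n × Fin n → Set Ω := fun W e =>
    {ω | (∀ a k, |X ω a k| ≤ L) ∧
        r ≤ |∑ k, (∑ l, W k e.1 l * X ω l k) ^ 3 * X ω e.2 k - ∑ k, meanGrad θ (W k) e.1 e.2|}
    with hbad
  have tails : ∀ W : (Σ i, Fin (q i)) → Matrix (Fin n) (Fin n) ℝ,
      (∀ k, W k ∈ Matrix.orthogonalGroup (Fin n) ℝ) →
      μ.real (⋃ e, bad W e) ≤ 2 * (n : ℝ) ^ 2 * E := fun W hW => by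
    refine (measureReal_iUnion_fintype_le _).trans
      ((Finset.sum_le_sum fun e _ => tail W hW e).trans (le_of_eq ?_))
    simp
    ring
  have hbig := measure_exists_entry_gt_le hθ.le hX hL0.le
  rw [hcard] at hbig
  -- Letting the orthogonal matrix depend on the column treats both gradients by one tail bound:
  -- constant for the centralized one, constant on each block for the local ones.
  set W₁ : (Σ i, Fin (q i)) → Matrix (Fin n) (Fin n) ℝ := fun _ => A * D with hW₁
  set W₂ : (Σ i, Fin (q i)) → Matrix (Fin n) (Fin n) ℝ := fun k => Aloc k.1 * D with hW₂
  have hb1 := tails W₁ fun _ => hU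
  have hb2 := tails W₂ fun k => hV k.1
  set G := {ω | ∀ a k, |X ω a k| ≤ L} with hG
  set T := {ω |
            0 < sigmaMin (cubicGrad (A * D) (X ω))
                + sigmaMin (∑ i, cubicGrad (Aloc i * D) (localBlock (X ω) i)) ∧
            2 * ‖cubicGrad (A * D) (X ω)
                  - ∑ i, cubicGrad (Aloc i * D) (localBlock (X ω) i)‖ /
              (sigmaMin (cubicGrad (A * D) (X ω))
                + sigmaMin (∑ i, cubicGrad (Aloc i * D) (localBlock (X ω) i))) < α * δ} with hT
  -- Covering the whole space and using subadditivity avoids any measurability question about `T`,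
  -- hence about singular values.
  have hcover : Set.univ ⊆ T ∪ (Gᶜ ∪ ((⋃ e, bad W₁ e) ∪ ⋃ e, bad W₂ e)) := by
    intro ω _
    by_contra hω
    simp only [Set.mem_union, Set.mem_compl_iff, Set.mem_iUnion, not_or, not_not, not_exists] at hω
    obtain ⟨hωT, hωG, hω1, hω2⟩ := hω
    refine hωT (ratio_lt_of_near_mean hn hpq hp0 hθ hα.1 hα.2 hU hV hP hUP hVP hε1 hUV hδ
      (hCdef ▸ hC) ?_ ?_)
    · rw [← hCdef]
      refine norm_lt_of_entries_lt hn _ fun i j => ?_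
      have h := hω1 (i, j)
      have h' : ¬ r ≤ _ := fun hh => h ⟨hωG, hh⟩
      rw [not_le] at h'
      rw [Matrix.sub_apply, cubicGrad_apply]
      convert! h' using 3
      simp [hW₁, hpq]
    · rw [← hCdef]
      refine norm_lt_of_entries_lt hn _ fun i j => ?_
      have h := hω2 (i, j)
      have h' : ¬ r ≤ _ := fun hh => h ⟨hωG, hh⟩
      rw [not_le] at h'
      rw [Matrix.sub_apply, sum_cubicGrad_localBlock_apply]
      convert! h' using 3
      simp [hW₂, Matrix.sum_apply, Fintype.sum_sigma]
  have htot : (1 : ℝ) ≤ μ.real T + (μ.real Gᶜ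
      + (μ.real (⋃ e, bad W₁ e) + μ.real (⋃ e, bad W₂ e))) := by
    calc (1 : ℝ) = μ.real Set.univ := probReal_univ.symm
      _ ≤ _ := measureReal_mono hcover
      _ ≤ _ := (measureReal_union_le _ _).trans (add_le_add_right ((measureReal_union_le _ _).trans
          (add_le_add_right (measureReal_union_le _ _) _)) _)
  have e1 : 0 ≤ (n : ℝ) * p * θ * Real.exp (-(L ^ 2 / 2)) := by positivity
  have e2 : 0 ≤ (n : ℝ) ^ 2 * E := by positivity
  -- The failure probability obtained is `2npθ exp(-L²/2) + 4n² E`, so both factors `8` leave room.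
  linarith
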